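/- Let $U:L^2(\mathbb R)\to\mathcal H$ be a unitary map onto a complex Hilbert space $\mathcal H$, and let $Q$ and $P$ be the operators in $\mathcal H$ which $U$ carries over from the position operator (multiplication by $t$ on its maximal domain) and the momentum operator ($-i\,d/dt$ with its natural self-adjoint domain) in $L^2(\mathbb R)$. Powers and products of unbounded operators have their natural domains, and $A^0=I$. Put $W(q,p)=UW_0(q,p)U^{-1}$, where $(W_0(q,p)f)(t)=e^{\frac i2qp}e^{ipt}f(t+q)$. Let $T$ be a positive trace class operator on $\mathcal H$ with $\mathrm{Tr}[T]=1$, and let $E^T$ be the translation covariant observable on the phase space $\mathbb R^2$ generated by $T$, that is, the positive operator measure $$E^T(B)=\frac1{2\pi}\int_B W(-q,p)\,T\,W(-q,p)^*\,dq\,dp\qquad(B\subset\mathbb R^2\text{ Borel}),$$ where the integral is understood weakly. For a measurable function $f:\mathbb R^2\to\mathbb C$ let $L(f,E^T)$ be the operator integral: its domain $D(f,E^T)$ consists of all $\varphi\in\mathcal H$ such that $f$ is integrable with respect to the complex measure $E^T_{\psi,\varphi}:B\mapsto\langle\psi|E^T(B)\varphi\rangle$ for every $\psi\in\mathcal H$,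 and $\langle\psi|L(f,E^T)\varphi\rangle=\int f\,dE^T_{\psi,\varphi}$ for all $\varphi\in D(f,E^T)$ and $\psi\in\mathcal H$. For $k\in\mathbb N=\{0,1,2,\dots\}$ let $x^k$ and $y^k$ denote the functions $(q,p)\mapsto q^k$ and $(q,p)\mapsto p^k$. (a) If $Q^k\sqrt T$ is a Hilbert–Schmidt operator (in particular everywhere defined), then $Q^{k-l}T$ is an (everywhere defined) trace class operator for each $l=0,\dots,k$, and $$L(x^k,E^T)=\sum_{l=0}^k\binom kl(-1)^{k-l}\,\mathrm{Tr}[Q^{k-l}T]\;Q^l$$ as an equality of unbounded operators, including the equality of their domains. (b) If $P^k\sqrt T$ is a Hilbert–Schmidt operator, then $P^{k-l}T$ is a trace class operator for each $l=0,\dots,k$, and $$L(y^k,E^T)=\sum_{l=0}^k\binom kl(-1)^{k-l}\,\mathrm{Tr}[P^{k-l}T]\;P^l$$ as an equality of unbounded operators, including the equality of their domains. -/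

import Mathlib

open MeasureTheory Filter
open scoped ENNReal InnerProductSpace Topology

namespace PhaseSpaceQuantization

noncomputable section

section Abstract

variable {Ω : Type*} [MeasurableSpace Ω]
variable {H : Type*} [NormedAddCommGroup H] [InnerProductSpace ℂ H]

/-! ### Positive operator measures and the operator integral -/

variable (Ω H) in
/-- A positive operator measure on `Ω`: a set function on the measurable sets (extended by `0` to
the other sets, as Mathlib does for vector measures) with values in the positive bounded operators
on `H`, σ-additive in the weak operator topology. -/
structure PositiveOperatorMeasure where
  toFun : Set Ω → (H →L[ℂ] H)
  isPositive : ∀ B, (toFun B).IsPositive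
  not_measurable : ∀ B, ¬ MeasurableSet B → toFun B = 0
  empty : toFun ∅ = 0
  hasSum_inner : ∀ B : ℕ → Set Ω, (∀ i, MeasurableSet (B i)) →
    Pairwise (Function.onFun Disjoint B) →
    ∀ ψ φ : H, HasSum (fun i => ⟪ψ, toFun (B i) φ⟫_ℂ) ⟪ψ, toFun (⋃ i, B i) φ⟫_ℂ

namespace PositiveOperatorMeasure

@[ext]
theorem ext {E F : PositiveOperatorMeasure Ω H} (h : ∀ B, E.toFun B = F.toFun B) : E = F := by
  cases E
  cases F
  congr
  exact funext h

/-- The zero operator measure. -/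
instance : Inhabited (PositiveOperatorMeasure Ω H) where
  default :=
    { toFun := fun _ => 0
      isPositive := fun _ => ContinuousLinearMap.isPositive_zero
      not_measurable := fun _ _ => rfl
      empty := rfl
      hasSum_inner := fun _ _ _ ψ φ => by simp }

/-- The complex measure `E_{ψ,φ} : B ↦ ⟪ψ, E(B) φ⟫`. -/
def scalar (E : PositiveOperatorMeasure Ω H) (ψ φ : H) : ComplexMeasure Ω where
  measureOf' B := ⟪ψ, E.toFun B φ⟫_ℂ
  empty' := by simp [E.empty]
  not_measurable' B hB := by simp [E.not_measurable B hB]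
  m_iUnion' B hB hd := E.hasSum_inner B hB hd ψ φ

/-- The integral `∫ f dE_{ψ,φ}` of a complex function with respect to the complex measure
`E_{ψ,φ}`. -/
def integral (E : PositiveOperatorMeasure Ω H) (f : Ω → ℂ) (ψ φ : H) : ℂ :=
  (E.scalar ψ φ).integral f (ContinuousLinearMap.mul ℝ ℂ)

variable (E : PositiveOperatorMeasure Ω H) (f : Ω → ℂ)

theorem scalar_apply (ψ φ : H) (B : Set Ω) : E.scalar ψ φ B = ⟪ψ, E.toFun B φ⟫_ℂ := rfl

theorem scalar_add_right (ψ φ φ' : H) :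
    E.scalar ψ (φ + φ') = E.scalar ψ φ + E.scalar ψ φ' := by
  ext B hB
  simp [scalar_apply]

theorem scalar_smul_right (c : ℂ) (ψ φ : H) :
    E.scalar ψ (c • φ) = c • E.scalar ψ φ := by
  ext B hB
  simp [scalar_apply]

theorem scalar_zero_right (ψ : H) : E.scalar ψ 0 = 0 := by
  ext B hB
  simp [scalar_apply]

theorem integrable_smul {μ : ComplexMeasure Ω} (c : ℂ) (h : μ.Integrable f) :
    (c • μ).Integrable f := by
  refine Integrable.mono_measure (Integrable.smul_measure_nnreal h (c := ‖c‖₊)) ?_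
  simp [VectorMeasure.variation_smul]

/-- The subspace `D(f,E)` of all `φ` such that `f` is `E_{ψ,φ}`-integrable (that is, integrable
with respect to the total variation of `E_{ψ,φ}`) for every `ψ`. -/
def domain : Submodule ℂ H where
  carrier := {φ | ∀ ψ : H, (E.scalar ψ φ).Integrable f}
  zero_mem' := fun ψ => by
    rw [scalar_zero_right]
    exact VectorMeasure.Integrable.zero_vectorMeasure
  add_mem' := fun {a b} ha hb ψ => by
    rw [scalar_add_right]
    exact VectorMeasure.Integrable.add_vectorMeasure (ha ψ) (hb ψ)
  smul_mem' := fun c a ha ψ => by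
    rw [scalar_smul_right]
    exact integrable_smul f c (ha ψ)

variable {f}

theorem integral_eq_lim {μ : ComplexMeasure Ω} (hf : Measurable f) (h : μ.Integrable f) :
    Tendsto (fun n => ∑ c ∈ (SimpleFunc.approxOn f hf (Set.range f ∪ {0}) 0 (by simp) n).range,
      c * μ ((SimpleFunc.approxOn f hf (Set.range f ∪ {0}) 0 (by simp) n) ⁻¹' {c})) atTop
      (𝓝 (μ.integral f (ContinuousLinearMap.mul ℝ ℂ))) := by
  have hint : ∀ n, Integrable
      (SimpleFunc.approxOn f hf (Set.range f ∪ {0}) 0 (by simp) n) μ.variation :=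
    fun n => SimpleFunc.integrable_approxOn_range hf h n
  have hlim := VectorMeasure.tendsto_integral_of_L1 (μ := μ) (B := ContinuousLinearMap.mul ℝ ℂ)
    f h.1 (Eventually.of_forall hint) (l := atTop)
    (SimpleFunc.tendsto_approxOn_range_L1_enorm hf h)
  refine hlim.congr fun n => ?_
  rw [VectorMeasure.integral_eq_setToFun, setToFun_simpleFunc _ _ (hint n)]
  rfl

/-- For `φ ∈ D(f,E)` the functional `ψ ↦ ∫ f dE_{ψ,φ}` is represented by a vector. -/
theorem exists_inner_eq_integral [CompleteSpace H] (hf : Measurable f) {φ : H}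
    (hφ : φ ∈ E.domain f) : ∃ η : H, ∀ ψ : H, ⟪ψ, η⟫_ℂ = E.integral f ψ φ := by
  let g := fun n => SimpleFunc.approxOn f hf (Set.range f ∪ {0}) 0 (by simp) n
  let η : ℕ → H := fun n => ∑ c ∈ (g n).range, c • E.toFun (g n ⁻¹' {c}) φ
  have hη : ∀ ψ, Tendsto (fun n => ⟪ψ, η n⟫_ℂ) atTop (𝓝 (E.integral f ψ φ)) := by
    intro ψ
    refine (integral_eq_lim hf (hφ ψ)).congr fun n => ?_
    simp [η, g, scalar_apply]
  have hη' : Tendsto (fun n ψ => innerSL ℂ (η n) ψ) atTop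
      (𝓝 (fun ψ => (starRingEnd ℂ) (E.integral f ψ φ))) := by
    refine tendsto_pi_nhds.2 fun ψ => ?_
    refine ((Complex.continuous_conj.tendsto _).comp (hη ψ)).congr fun n => ?_
    simp
  let ℓ : H →L[ℂ] ℂ := continuousLinearMapOfTendsto (fun n => innerSL ℂ (η n)) hη'
  refine ⟨(InnerProductSpace.toDual ℂ H).symm ℓ, fun ψ => ?_⟩
  rw [← inner_conj_symm, InnerProductSpace.toDual_symm_apply]
  change (starRingEnd ℂ) ((starRingEnd ℂ) (E.integral f ψ φ)) = _
  simp

theorem integral_add_right {φ φ' : H} (ψ : H) (h : φ ∈ E.domain f) (h' : φ' ∈ E.domain f) :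
    E.integral f ψ (φ + φ') = E.integral f ψ φ + E.integral f ψ φ' := by
  rw [integral, scalar_add_right, VectorMeasure.integral_add_vectorMeasure (h ψ) (h' ψ)]
  rfl

theorem integral_smul_right (hf : Measurable f) {φ : H} (ψ : H) (c : ℂ) (h : φ ∈ E.domain f) :
    E.integral f ψ (c • φ) = c * E.integral f ψ φ := by
  refine tendsto_nhds_unique (integral_eq_lim hf ((E.domain f).smul_mem c h ψ)) ?_
  refine ((integral_eq_lim hf (h ψ)).const_mul c).congr fun n => ?_
  simp only [scalar_smul_right, Finset.mul_sum]
  refine Finset.sum_congr rfl fun d _ => ?_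
  simp only [FunLike.coe_smul, Pi.smul_apply, smul_eq_mul]
  ring

/-- The operator integral `L(f,E) = ∫ f dE` of a measurable function `f`: the linear operator with
domain `D(f,E)` determined by `⟪ψ, L(f,E) φ⟫ = ∫ f dE_{ψ,φ}` for all `ψ`. -/
def operatorIntegral [CompleteSpace H] (hf : Measurable f) : H →ₗ.[ℂ] H where
  domain := E.domain f
  toFun :=
    { toFun := fun φ => (E.exists_inner_eq_integral hf φ.2).choose
      map_add' := fun a b => by
        refine ext_inner_left ℂ fun ψ => ?_
        rw [inner_add_right, (E.exists_inner_eq_integral hf (a + b).2).choose_spec ψ,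
          (E.exists_inner_eq_integral hf a.2).choose_spec ψ,
          (E.exists_inner_eq_integral hf b.2).choose_spec ψ]
        exact E.integral_add_right ψ a.2 b.2
      map_smul' := fun c a => by
        refine ext_inner_left ℂ fun ψ => ?_
        rw [inner_smul_right, (E.exists_inner_eq_integral hf (c • a).2).choose_spec ψ,
          RingHom.id_apply, (E.exists_inner_eq_integral hf a.2).choose_spec ψ]
        exact E.integral_smul_right hf ψ c a.2 }

theorem inner_operatorIntegral [CompleteSpace H] (hf : Measurable f) (ψ : H)
    (φ : (E.operatorIntegral hf).domain) :
    ⟪ψ, E.operatorIntegral hf φ⟫_ℂ = E.integral f ψ φ :=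
  (E.exists_inner_eq_integral hf φ.2).choose_spec ψ

end PositiveOperatorMeasure

/-! ### Unbounded operators: products, powers, unitary transport -/

/-- A bounded operator as an everywhere defined operator. -/
def ofBounded (S : H →L[ℂ] H) : H →ₗ.[ℂ] H := (S : H →ₗ[ℂ] H).toPMap ⊤

/-- The product `A B` of two operators, on its natural domain `{φ ∈ D(B) | B φ ∈ D(A)}`. -/
def prodOp (A B : H →ₗ.[ℂ] H) : H →ₗ.[ℂ] H where
  domain :=
    { carrier := {φ | ∃ h : φ ∈ B.domain, B ⟨φ, h⟩ ∈ A.domain}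
      zero_mem' := ⟨B.domain.zero_mem, by
        have : B ⟨0, B.domain.zero_mem⟩ = 0 := B.map_zero
        rw [this]
        exact A.domain.zero_mem⟩
      add_mem' := by
        rintro a b ⟨ha, ha'⟩ ⟨hb, hb'⟩
        refine ⟨B.domain.add_mem ha hb, ?_⟩
        have : B ⟨a + b, B.domain.add_mem ha hb⟩ = B ⟨a, ha⟩ + B ⟨b, hb⟩ :=
          B.map_add ⟨a, ha⟩ ⟨b, hb⟩
        rw [this]
        exact A.domain.add_mem ha' hb'
      smul_mem' := by
        rintro c a ⟨ha, ha'⟩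
        refine ⟨B.domain.smul_mem c ha, ?_⟩
        have : B ⟨c • a, B.domain.smul_mem c ha⟩ = c • B ⟨a, ha⟩ := B.map_smul c ⟨a, ha⟩
        rw [this]
        exact A.domain.smul_mem c ha' }
  toFun :=
    { toFun := fun φ => A ⟨B ⟨φ, φ.2.fst⟩, φ.2.snd⟩
      map_add' := fun a b => by
        rw [← A.map_add]
        congr 1
        exact Subtype.ext (B.map_add ⟨a, a.2.fst⟩ ⟨b, b.2.fst⟩)
      map_smul' := fun c a => by
        rw [RingHom.id_apply, ← A.map_smul]
        congr 1
        exact Subtype.ext (B.map_smul c ⟨a, a.2.fst⟩) }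

/-- The powers `A ^ k` of an operator on their natural domains, with `A ^ 0 = I`. -/
def powOp (A : H →ₗ.[ℂ] H) : ℕ → (H →ₗ.[ℂ] H)
  | 0 => ofBounded (ContinuousLinearMap.id ℂ H)
  | k + 1 => prodOp A (powOp A k)

/-- The operator `U A U⁻¹`, with domain `U D(A)`, for a unitary map `U : K → H`. -/
def transport {K : Type*} [NormedAddCommGroup K] [InnerProductSpace ℂ K]
    (U : K ≃ₗᵢ[ℂ] H) (A : K →ₗ.[ℂ] K) : H →ₗ.[ℂ] H where
  domain := A.domain.comap (U.symm.toLinearEquiv : H →ₗ[ℂ] K)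
  toFun :=
    { toFun := fun φ => U (A ⟨U.symm φ, φ.2⟩)
      map_add' := fun a b => by
        rw [← map_add, ← A.map_add]
        congr 2
        exact Subtype.ext (map_add U.symm (a : H) b)
      map_smul' := fun c a => by
        rw [RingHom.id_apply, ← map_smul, ← A.map_smul]
        congr 2
        exact Subtype.ext (map_smul U.symm c (a : H)) }

/-! ### Hilbert-Schmidt operators, trace class operators, trace -/

variable [CompleteSpace H]

variable (H) in
/-- The index set of an orthonormal basis of `H`, fixed once and for all. -/
def basisIndex : Set H := (exists_hilbertBasis ℂ H).choose

variable (H) in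
/-- An orthonormal basis of `H`, fixed once and for all. The three notions below do not depend on
its choice. -/
def onb : HilbertBasis (basisIndex H) ℂ H := (exists_hilbertBasis ℂ H).choose_spec.choose

/-- `A` is a Hilbert-Schmidt operator: it is everywhere defined and bounded, and
`∑ ‖A eᵢ‖²` is finite for an orthonormal basis `(eᵢ)`. -/
def IsHilbertSchmidt (A : H →ₗ.[ℂ] H) : Prop :=
  ∃ S : H →L[ℂ] H, A = ofBounded S ∧ Summable (fun i => ‖S (onb H i)‖ ^ 2)

/-- `A` is a trace class operator: it is everywhere defined and bounded, and
`∑ ⟪eᵢ, |A| eᵢ⟫` is finite for an orthonormal basis `(eᵢ)`, where `|A| = √(A* A)`. -/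
def IsTraceClass (A : H →ₗ.[ℂ] H) : Prop :=
  ∃ S : H →L[ℂ] H, A = ofBounded S ∧
    Summable (fun i => (⟪onb H i, CFC.abs S (onb H i)⟫_ℂ).re)

open scoped Classical in
/-- The trace `∑ ⟪eᵢ, A eᵢ⟫` of an operator `A`, meaningful when `A` is a trace class operator (so
that the basis vectors `eᵢ` are in its domain and the series converges absolutely). -/
def trace (A : H →ₗ.[ℂ] H) : ℂ :=
  ∑' i, if h : (onb H i : H) ∈ A.domain then ⟪(onb H i : H), A ⟨onb H i, h⟩⟫_ℂ else 0

end Abstract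

/-! ### Position, momentum and the Weyl operators -/

/-- The Hilbert space `L²(ℝ)` with Lebesgue measure. -/
abbrev L2R : Type := Lp ℂ 2 (volume : Measure ℝ)

/-- The position operator in `L²(ℝ)`: multiplication by `t`, on the maximal domain. -/
def position : L2R →ₗ.[ℂ] L2R where
  domain :=
    { carrier := {f | MemLp (fun t : ℝ => (t : ℂ) * f t) 2 volume}
      zero_mem' := by
        refine (MemLp.zero' : MemLp (fun _ : ℝ => (0 : ℂ)) 2 volume).ae_eq ?_
        filter_upwards [Lp.coeFn_zero ℂ 2 (volume : Measure ℝ)] with t ht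
        simp [ht]
      add_mem' := by
        intro f g hf hg
        refine (MemLp.add hf hg).ae_eq ?_
        filter_upwards [Lp.coeFn_add f g] with t ht
        rw [ht]
        simp only [Pi.add_apply, mul_add]
      smul_mem' := by
        intro c f hf
        refine (MemLp.const_smul hf c).ae_eq ?_
        filter_upwards [Lp.coeFn_smul c f] with t ht
        simp only [Pi.smul_apply, ht, smul_eq_mul]
        ring }
  toFun :=
    { toFun := fun f => MemLp.toLp (fun t : ℝ => (t : ℂ) * (f : L2R) t) f.2
      map_add' := fun f g => by
        rw [← MemLp.toLp_add]
        refine MemLp.toLp_congr _ _ ?_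
        filter_upwards [Lp.coeFn_add (f : L2R) (g : L2R)] with t ht
        rw [Submodule.coe_add, ht]
        simp only [Pi.add_apply, mul_add]
      map_smul' := fun c f => by
        rw [RingHom.id_apply, ← MemLp.toLp_const_smul]
        refine MemLp.toLp_congr _ _ ?_
        filter_upwards [Lp.coeFn_smul c (f : L2R)] with t ht
        simp only [Submodule.coe_smul, Pi.smul_apply, ht, smul_eq_mul]
        ring }

/-- The momentum operator `-i d/dt` in `L²(ℝ)`, namely `F⁻¹ M F`, where `F` is Mathlib's `L²` Fourier
transform `(F f)(ξ) = ∫ f(t) exp(-2πi t ξ) dt` and `M` is multiplication by `2πξ` on its maximal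
domain. -/
def momentum : L2R →ₗ.[ℂ] L2R :=
  transport (Lp.fourierTransformₗᵢ ℝ ℂ).symm ((2 * (Real.pi : ℂ)) • position)

theorem memLp_weyl (q p : ℝ) (f : L2R) :
    MemLp (fun t : ℝ => Complex.exp (Complex.I * (q * p / 2)) * Complex.exp (Complex.I * (p * t)) *
      f (t + q)) 2 volume := by
  have h1 : MemLp (fun t : ℝ => f (t + q)) 2 volume :=
    (Lp.memLp f).comp_measurePreserving (measurePreserving_add_right volume q)
  refine h1.of_le ?_ (Eventually.of_forall fun t => ?_)
  · refine AEStronglyMeasurable.mul (Continuous.aestronglyMeasurable (by fun_prop)) h1.1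
  · rw [norm_mul, norm_mul]
    have e1 : ‖Complex.exp (Complex.I * (q * p / 2))‖ = 1 := by
      have := Complex.norm_exp_I_mul_ofReal (q * p / 2)
      push_cast at this
      exact this
    have e2 : ‖Complex.exp (Complex.I * (p * t))‖ = 1 := by
      have := Complex.norm_exp_I_mul_ofReal (p * t)
      push_cast at this
      exact this
    simp [e1, e2]

/-- The Weyl operators `(W₀(q,p) f)(t) = exp(i q p / 2) exp(i p t) f(t + q)` on `L²(ℝ)`. -/
def weyl₀ (q p : ℝ) : L2R →ₗᵢ[ℂ] L2R where
  toFun f := MemLp.toLp _ (memLp_weyl q p f)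
  map_add' f g := by
    rw [← MemLp.toLp_add]
    refine MemLp.toLp_congr _ _ ?_
    have h := (measurePreserving_add_right (volume : Measure ℝ) q).quasiMeasurePreserving.ae
      (Lp.coeFn_add f g)
    filter_upwards [h] with t ht
    rw [ht]
    simp only [Pi.add_apply, mul_add]
  map_smul' c f := by
    rw [RingHom.id_apply, ← MemLp.toLp_const_smul]
    refine MemLp.toLp_congr _ _ ?_
    have h := (measurePreserving_add_right (volume : Measure ℝ) q).quasiMeasurePreserving.ae
      (Lp.coeFn_smul c f)
    filter_upwards [h] with t ht
    simp only [Pi.smul_apply, ht, smul_eq_mul]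
    ring
  norm_map' f := by
    change ‖MemLp.toLp _ (memLp_weyl q p f)‖ = ‖f‖
    rw [Lp.norm_toLp, Lp.norm_def]
    congr 1
    rw [← eLpNorm_comp_measurePreserving (Lp.aestronglyMeasurable f)
      (measurePreserving_add_right (volume : Measure ℝ) q)]
    refine eLpNorm_congr_norm_ae (Eventually.of_forall fun t => ?_)
    have e1 : ‖Complex.exp (Complex.I * (q * p / 2))‖ = 1 := by
      have := Complex.norm_exp_I_mul_ofReal (q * p / 2)
      push_cast at this
      exact this
    have e2 : ‖Complex.exp (Complex.I * (p * t))‖ = 1 := by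
      have := Complex.norm_exp_I_mul_ofReal (p * t)
      push_cast at this
      exact this
    simp [e1, e2]

section PhaseSpace

variable {H : Type*} [NormedAddCommGroup H] [InnerProductSpace ℂ H] [CompleteSpace H]

/-- The position operator `Q` in `H`, carried over by the unitary map `U : L²(ℝ) → H`. -/
def opQ (U : L2R ≃ₗᵢ[ℂ] H) : H →ₗ.[ℂ] H := transport U position

/-- The momentum operator `P` in `H`, carried over by the unitary map `U : L²(ℝ) → H`. -/
def opP (U : L2R ≃ₗᵢ[ℂ] H) : H →ₗ.[ℂ] H := transport U momentum

/-- The Weyl operators `W(q,p) = U W₀(q,p) U⁻¹` on `H`. -/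
def weyl (U : L2R ≃ₗᵢ[ℂ] H) (q p : ℝ) : H →L[ℂ] H :=
  (U : L2R →L[ℂ] H) ∘L (weyl₀ q p).toContinuousLinearMap ∘L (U.symm : H →L[ℂ] L2R)

/-- The phase space translations `β(q,p)(T) = W(-q,p) T W(-q,p)*`. -/
def beta (U : L2R ≃ₗᵢ[ℂ] H) (z : ℝ × ℝ) (T : H →L[ℂ] H) : H →L[ℂ] H :=
  weyl U (-z.1) z.2 ∘L T ∘L ContinuousLinearMap.adjoint (weyl U (-z.1) z.2)

/-- `E(B) = (2π)⁻¹ ∫_B β(q,p)(T) dq dp` for every Borel set `B`, as a weak integral. -/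
def IsGeneratedBy (U : L2R ≃ₗᵢ[ℂ] H) (T : H →L[ℂ] H)
    (E : PositiveOperatorMeasure (ℝ × ℝ) H) : Prop :=
  ∀ B : Set (ℝ × ℝ), MeasurableSet B → ∀ ψ φ : H,
    IntegrableOn (fun z => ⟪ψ, beta U z T φ⟫_ℂ) B ∧
    ⟪ψ, E.toFun B φ⟫_ℂ = (2 * (Real.pi : ℂ))⁻¹ * ∫ z in B, ⟪ψ, beta U z T φ⟫_ℂ

theorem IsGeneratedBy.unique {U : L2R ≃ₗᵢ[ℂ] H} {T : H →L[ℂ] H}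
    {E F : PositiveOperatorMeasure (ℝ × ℝ) H} (hE : IsGeneratedBy U T E)
    (hF : IsGeneratedBy U T F) : E = F := by
  ext B φ
  by_cases hB : MeasurableSet B
  · refine ext_inner_left ℂ fun ψ => ?_
    rw [(hE B hB ψ φ).2, (hF B hB ψ φ).2]
  · rw [E.not_measurable B hB, F.not_measurable B hB]

open scoped Classical in
/-- The translation covariant observable `E^T` generated by `T`, that is, the unique positive
operator measure `E` on the phase space `ℝ²` with `E(B) = (2π)⁻¹ ∫_B β(q,p)(T) dq dp`. (If there
were none, as when `T` is not of trace class, the value would be the zero measure.) -/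
def covariantObservable (U : L2R ≃ₗᵢ[ℂ] H) (T : H →L[ℂ] H) :
    PositiveOperatorMeasure (ℝ × ℝ) H :=
  if h : ∃ E, IsGeneratedBy U T E then h.choose else default

/-- The function `x^k : (q,p) ↦ q^k` on the phase space. -/
def xPow (k : ℕ) (z : ℝ × ℝ) : ℂ := (z.1 : ℂ) ^ k

/-- The function `y^k : (q,p) ↦ p^k` on the phase space. -/
def yPow (k : ℕ) (z : ℝ × ℝ) : ℂ := (z.2 : ℂ) ^ k

theorem measurable_xPow (k : ℕ) : Measurable (xPow k) := by
  unfold xPow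
  fun_prop

theorem measurable_yPow (k : ℕ) : Measurable (yPow k) := by
  unfold yPow
  fun_prop

/-- The polynomial `∑_{l=0}^k C(k,l) (-1)^{k-l} Tr[A^{k-l} T] A^l` in the operator `A`, on its
natural domain, the intersection of the domains of the `A^l`. -/
def momentPolynomial (A : H →ₗ.[ℂ] H) (T : H →L[ℂ] H) (k : ℕ) : H →ₗ.[ℂ] H :=
  ∑ l ∈ Finset.range (k + 1),
    ((k.choose l : ℂ) * (-1) ^ (k - l) * trace (prodOp (powOp A (k - l)) (ofBounded T))) • powOp A l

end PhaseSpace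

end

end PhaseSpaceQuantization

open PhaseSpaceQuantization

/-!
By Plancherel's theorem, the distribution of `q` under the covariant observable `E^T` in a vector
state `φ` is that of a difference `X - Y` of independent random variables, where `X` has the
distribution of the position `Q` in the state `φ` and `Y` that of `Q` in the state `T`. The
Hilbert-Schmidt condition says that `Y` has a finite moment of order `2k`. Expanding `(X - Y)^k`
shows that `L(x^k, E^T)` is a symmetric extension of `p(Q)`, where `p(t)` is the mean of
`(t - Y)^k`, a real polynomial in `t`. Since `p(Q)` is self-adjoint, the two operators are equal.
The Fourier transform rotates the phase space by a right angle, and so reduces the momentum to the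
position.
-/

open MeasureTheory Filter
open scoped ENNReal InnerProductSpace Topology FourierTransform

namespace PhaseSpaceQuantization

section PartialOperators

variable {H : Type*} [NormedAddCommGroup H] [InnerProductSpace ℂ H]

theorem ofBounded_injective : Function.Injective (ofBounded : (H →L[ℂ] H) → H →ₗ.[ℂ] H) := by
  intro S S' h
  ext x
  exact (le_of_eq h).2 (x := ⟨x, trivial⟩) (y := ⟨x, trivial⟩) rfl

theorem prodOp_ofBounded_eq_iff {A : H →ₗ.[ℂ] H} {S C : H →L[ℂ] H} :
    prodOp A (ofBounded S) = ofBounded C ↔ ∀ x, ∃ h : S x ∈ A.domain, A ⟨S x, h⟩ = C x := by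
  constructor
  · intro h x
    have hx : x ∈ (prodOp A (ofBounded S)).domain := h ▸ trivial
    exact ⟨hx.2, (le_of_eq h).2 (x := ⟨x, hx⟩) (y := ⟨x, trivial⟩) rfl⟩
  · intro h
    refine LinearPMap.ext (le_antisymm le_top fun x _ => ⟨trivial, (h x).1⟩) ?_
    exact fun x _ _ => (h x).2

theorem prodOp_ofBounded_comp {A : H →ₗ.[ℂ] H} {S C : H →L[ℂ] H}
    (h : prodOp A (ofBounded S) = ofBounded C) (X : H →L[ℂ] H) :
    prodOp A (ofBounded (S ∘L X)) = ofBounded (C ∘L X) :=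
  prodOp_ofBounded_eq_iff.2 fun x => prodOp_ofBounded_eq_iff.1 h (X x)

theorem exists_prodOp_ofBounded_eq {A : H →ₗ.[ℂ] H} {S : H →L[ℂ] H} {c : ℝ}
    (h : ∀ x, ∃ hx : S x ∈ A.domain, ‖A ⟨S x, hx⟩‖ ≤ c * ‖x‖) :
    ∃ C : H →L[ℂ] H, prodOp A (ofBounded S) = ofBounded C := by
  let C : H →ₗ[ℂ] H := A.toFun ∘ₗ (S : H →ₗ[ℂ] H).codRestrict A.domain fun x => (h x).1
  exact ⟨C.mkContinuous c fun x => (h x).2,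
    prodOp_ofBounded_eq_iff.2 fun x => ⟨(h x).1, rfl⟩⟩

theorem inner_eq_zero_of_inner_self_eq_zero {D : Submodule ℂ H} {X : D →ₗ[ℂ] H}
    (h : ∀ φ : D, ⟪(φ : H), X φ⟫_ℂ = 0) (ψ φ : D) : ⟪(ψ : H), X φ⟫_ℂ = 0 := by
  have hsum : ⟪(φ : H), X ψ⟫_ℂ + ⟪(ψ : H), X φ⟫_ℂ = 0 := by
    simpa [inner_add_left, inner_add_right, h] using h (ψ + φ)
  have hdiff : ⟪(φ : H), X ψ⟫_ℂ - ⟪(ψ : H), X φ⟫_ℂ = 0 := by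
    have := h (φ + Complex.I • ψ)
    simp only [Submodule.coe_add, Submodule.coe_smul, map_add, map_smul, inner_add_left,
      inner_add_right, inner_smul_left, inner_smul_right, h, Complex.conj_I] at this
    linear_combination (-Complex.I) * this + (⟪(φ : H), X ψ⟫_ℂ - ⟪(ψ : H), X φ⟫_ℂ) * Complex.I_sq
  linear_combination (hsum - hdiff) / 2

variable {D : Submodule ℂ H}

theorem eq_zero_of_inner_self_eq_zero (hD : Dense (D : Set H)) {X : D →ₗ[ℂ] H}
    (h : ∀ φ : D, ⟪(φ : H), X φ⟫_ℂ = 0) : X = 0 := by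
  ext φ
  exact hD.eq_zero_of_inner_right ℂ fun ψ hψ =>
    inner_eq_zero_of_inner_self_eq_zero h ⟨ψ, hψ⟩ φ

theorem le_of_inner_self_eq {A L : H →ₗ.[ℂ] H} (hA : Dense (A.domain : Set H))
    (hle : A.domain ≤ L.domain)
    (h : ∀ φ : A.domain, ⟪(φ : H), L ⟨φ, hle φ.2⟩⟫_ℂ = ⟪(φ : H), A φ⟫_ℂ) : A ≤ L := by
  have hzero : A.toFun - L.toFun ∘ₗ Submodule.inclusion hle = 0 := by
    refine eq_zero_of_inner_self_eq_zero hA fun φ => ?_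
    rw [LinearMap.sub_apply, inner_sub_right, sub_eq_zero]
    exact (h φ).symm
  refine ⟨hle, fun {x y} hxy => ?_⟩
  obtain rfl : y = ⟨x, hle x.2⟩ := Subtype.ext hxy.symm
  exact LinearMap.congr_fun (sub_eq_zero.1 hzero) x

variable [CompleteSpace H]

theorem eq_of_isSelfAdjoint_of_le {A L : H →ₗ.[ℂ] H} (hA : IsSelfAdjoint A)
    (hL : L.IsFormalAdjoint L) (hle : A ≤ L) : L = A := by
  refine le_antisymm ?_ hle
  have hdense : Dense (A.domain : Set H) := hA.dense_domain
  rw [← LinearPMap.isSelfAdjoint_def.1 hA]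
  refine LinearPMap.IsFormalAdjoint.le_adjoint hdense fun x y => ?_
  have hx : A x = L ⟨x, hle.1 x.2⟩ := hle.2 rfl
  rw [hx]
  exact hL ⟨x, hle.1 x.2⟩ y

end PartialOperators

section MultiplicationOperators

theorem memLp_two_iff_lintegral_enorm_sq_lt_top {α E : Type*} [MeasurableSpace α] {μ : Measure α}
    [NormedAddCommGroup E] {f : α → E} (hf : AEStronglyMeasurable f μ) :
    MemLp f 2 μ ↔ ∫⁻ t, ‖f t‖ₑ ^ 2 ∂μ < ∞ := by
  rw [MemLp, and_iff_right hf,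
    eLpNorm_lt_top_iff_lintegral_rpow_enorm_lt_top two_ne_zero ENNReal.ofNat_ne_top]
  norm_num

theorem enorm_sq_eq_lintegral {α E : Type*} [MeasurableSpace α] {μ : Measure α}
    [NormedAddCommGroup E] (f : Lp E 2 μ) : ‖f‖ₑ ^ 2 = ∫⁻ t, ‖f t‖ₑ ^ 2 ∂μ := by
  rw [Lp.enorm_def, eLpNorm_eq_lintegral_rpow_enorm_toReal two_ne_zero ENNReal.ofNat_ne_top,
    ← ENNReal.rpow_natCast, ← ENNReal.rpow_mul]
  norm_num

variable {α : Type*} [MeasurableSpace α] {μ : Measure α}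
variable {H : Type*} [NormedAddCommGroup H] [InnerProductSpace ℂ H]

/-- Multiplication by the function `m` in `L²(μ)`, on its maximal domain. -/
noncomputable def mulL2 (μ : Measure α) (m : α → ℂ) : Lp ℂ 2 μ →ₗ.[ℂ] Lp ℂ 2 μ where
  domain :=
    { carrier := {f | MemLp (fun t => m t * f t) 2 μ}
      zero_mem' := by
        refine (MemLp.zero' : MemLp (fun _ : α => (0 : ℂ)) 2 μ).ae_eq ?_
        filter_upwards [Lp.coeFn_zero ℂ 2 μ] with t ht
        rw [ht, Pi.zero_apply, mul_zero]
      add_mem' := fun {f g} hf hg => by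
        refine (MemLp.add hf hg).ae_eq ?_
        filter_upwards [Lp.coeFn_add f g] with t ht
        rw [ht, Pi.add_apply, Pi.add_apply, mul_add]
      smul_mem' := fun c f hf => by
        refine (MemLp.const_smul hf c).ae_eq ?_
        filter_upwards [Lp.coeFn_smul c f] with t ht
        rw [ht, Pi.smul_apply, Pi.smul_apply, mul_smul_comm] }
  toFun :=
    { toFun := fun f => MemLp.toLp (fun t => m t * (f : Lp ℂ 2 μ) t) f.2
      map_add' := fun f g => by
        rw [← MemLp.toLp_add]
        refine MemLp.toLp_congr _ _ ?_
        filter_upwards [Lp.coeFn_add (f : Lp ℂ 2 μ) (g : Lp ℂ 2 μ)] with t ht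
        rw [Submodule.coe_add, ht, Pi.add_apply, Pi.add_apply, mul_add]
      map_smul' := fun c f => by
        rw [RingHom.id_apply, ← MemLp.toLp_const_smul]
        refine MemLp.toLp_congr _ _ ?_
        filter_upwards [Lp.coeFn_smul c (f : Lp ℂ 2 μ)] with t ht
        rw [Submodule.coe_smul, ht, Pi.smul_apply, Pi.smul_apply, mul_smul_comm] }

theorem smul_mulL2 {m : α → ℂ} {c : ℂ} (hc : c ≠ 0) :
    c • mulL2 μ m = mulL2 μ fun t => c * m t := by
  have hfun (f : α → ℂ) : (fun t => c * m t * f t) = c • fun t => m t * f t :=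
    funext fun t => mul_assoc _ _ _
  refine LinearPMap.ext (SetLike.ext fun f => ?_) fun f hf hf' => ?_
  · change MemLp _ 2 μ ↔ MemLp _ 2 μ
    rw [hfun]
    exact ⟨fun h => h.const_smul c, fun h => by simpa [smul_smul, hc] using h.const_smul c⁻¹⟩
  · exact (MemLp.toLp_const_smul c hf).symm.trans (MemLp.toLp_congr _ hf' (.of_eq (hfun f).symm))

/-- The operator in `H` which the unitary map `V : L²(μ) → H` carries over from multiplication by
the function `m`. -/
noncomputable def mulOp (V : Lp ℂ 2 μ ≃ₗᵢ[ℂ] H) (m : α → ℂ) : H →ₗ.[ℂ] H :=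
  transport V (mulL2 μ m)

variable {V : Lp ℂ 2 μ ≃ₗᵢ[ℂ] H} {m : α → ℂ}

theorem mem_mulOp_domain {φ : H} :
    φ ∈ (mulOp V m).domain ↔ MemLp (fun t => m t * V.symm φ t) 2 μ := Iff.rfl

theorem coeFn_symm_mulOp (φ : (mulOp V m).domain) :
    V.symm (mulOp V m φ) =ᵐ[μ] fun t => m t * V.symm φ t := by
  change V.symm (V _) =ᵐ[μ] _
  rw [V.symm_apply_apply]
  exact MemLp.coeFn_toLp (mem_mulOp_domain.1 φ.2)

theorem eq_mulOp_of_coeFn_symm {φ : (mulOp V m).domain} {ψ : H}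
    (h : V.symm ψ =ᵐ[μ] fun t => m t * V.symm φ t) : ψ = mulOp V m φ :=
  V.symm.injective (Lp.ext (h.trans (coeFn_symm_mulOp φ).symm))

theorem inner_mulOp (ψ : H) (φ : (mulOp V m).domain) :
    ⟪ψ, mulOp V m φ⟫_ℂ = ∫ t, ⟪V.symm ψ t, m t * V.symm φ t⟫_ℂ ∂μ := by
  rw [← V.symm.inner_map_map, L2.inner_def]
  refine integral_congr_ae ?_
  filter_upwards [coeFn_symm_mulOp φ] with t ht
  rw [ht]

theorem isFormalAdjoint_mulOp_conj :
    (mulOp V m).IsFormalAdjoint (mulOp V (fun t => starRingEnd ℂ (m t))) := by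
  intro φ ψ
  rw [← V.symm.inner_map_map, ← V.symm.inner_map_map (φ : H), L2.inner_def, L2.inner_def]
  refine integral_congr_ae ?_
  filter_upwards [coeFn_symm_mulOp φ, coeFn_symm_mulOp ψ] with t hφ hψ
  rw [hφ, hψ]
  simp only [RCLike.inner_apply, map_mul]
  ring

theorem memLp_cutoff_mul (hm : Measurable m) (N : ℕ) {f : α → ℂ} (hf : MemLp f 2 μ) :
    MemLp (fun t => {t | ‖m t‖ ≤ N}.indicator m t * f t) 2 μ := by
  refine hf.of_le_mul (c := N) ?_ (Eventually.of_forall fun t => ?_)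
  · exact (hm.indicator (hm.norm measurableSet_Iic)).aestronglyMeasurable.mul hf.1
  · rw [norm_mul]
    refine mul_le_mul_of_nonneg_right ?_ (norm_nonneg _)
    rw [norm_indicator_eq_indicator_norm]
    exact Set.indicator_apply_le' (fun ht => ht) fun _ => N.cast_nonneg

-- Tested on the cut-off of `χ - conj m * ψ` to a set on which `m` is bounded, the hypothesis says
-- that this cut-off is orthogonal to itself.
theorem coeFn_symm_eq_of_forall_inner_mulOp (hm : Measurable m) {χ ψ : H}
    (h : ∀ φ : (mulOp V m).domain, ⟪χ, φ⟫_ℂ = ⟪ψ, mulOp V m φ⟫_ℂ) :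
    V.symm χ =ᵐ[μ] fun t => starRingEnd ℂ (m t) * V.symm ψ t := by
  let d : α → ℂ := fun t => V.symm χ t - starRingEnd ℂ (m t) * V.symm ψ t
  have hcut (N : ℕ) : ∀ᵐ t ∂μ, ‖m t‖ ≤ N → d t = 0 := by
    let A : Set α := {t | ‖m t‖ ≤ N}
    have hA : MeasurableSet A := hm.norm measurableSet_Iic
    have hdA : MemLp (A.indicator d) 2 μ := by
      refine (((Lp.memLp (V.symm χ)).indicator hA).sub
        (memLp_cutoff_mul hm N (Lp.memLp (V.symm ψ)).star).star).ae_eq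
        (Eventually.of_forall fun t => ?_)
      by_cases ht : t ∈ A <;> simp [A, d, ht]
    let F : Lp ℂ 2 μ := hdA.toLp
    have hmF : MemLp (fun t => m t * F t) 2 μ := by
      refine (memLp_cutoff_mul hm N (Lp.memLp F)).ae_eq ?_
      filter_upwards [hdA.coeFn_toLp] with t ht
      by_cases htA : t ∈ A <;> simp [F, ht, A, htA]
    let φ : (mulOp V m).domain := ⟨V F, by rwa [mem_mulOp_domain, V.symm_apply_apply]⟩
    have hF : ⟪F, F⟫_ℂ = 0 := by
      have hint := h φ
      rw [← V.symm.inner_map_map, ← V.symm.inner_map_map ψ, V.symm_apply_apply, L2.inner_def,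
        L2.inner_def] at hint
      rw [L2.inner_def, ← sub_eq_zero.2 hint,
        ← integral_sub (L2.integrable_inner _ _) (L2.integrable_inner _ _)]
      refine integral_congr_ae ?_
      filter_upwards [hdA.coeFn_toLp, coeFn_symm_mulOp φ] with t ht htφ
      rw [htφ, V.symm_apply_apply, ht]
      by_cases htA : t ∈ A
      · rw [Set.indicator_of_mem htA]
        simp only [RCLike.inner_apply, d, map_sub, map_mul, RCLike.conj_conj]
        ring
      · simp [Set.indicator_of_notMem htA]
    filter_upwards [hdA.coeFn_toLp, Lp.eq_zero_iff_ae_eq_zero.1 (inner_self_eq_zero.1 hF)]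
      with t ht ht0 htA
    rw [← Set.indicator_of_mem (s := A) htA d, ← ht, ht0, Pi.zero_apply]
  filter_upwards [ae_all_iff.2 hcut] with t ht
  obtain ⟨N, hN⟩ := exists_nat_ge ‖m t‖
  exact sub_eq_zero.1 (ht N hN)

theorem dense_mulOp_domain [CompleteSpace H] (hm : Measurable m) :
    Dense ((mulOp V m).domain : Set H) := by
  rw [Submodule.dense_iff_topologicalClosure_eq_top,
    Submodule.topologicalClosure_eq_top_iff, Submodule.eq_bot_iff]
  intro χ hχ
  have hzero : V.symm χ =ᵐ[μ] fun t => starRingEnd ℂ (m t) * V.symm (0 : H) t :=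
    coeFn_symm_eq_of_forall_inner_mulOp hm fun φ => by
      rw [inner_zero_left, (Submodule.mem_orthogonal' _ _).1 hχ φ φ.2]
  refine (map_eq_zero_iff V.symm V.symm.injective).1 (Lp.eq_zero_iff_ae_eq_zero.2 ?_)
  filter_upwards [hzero, Lp.coeFn_zero ℂ 2 μ] with t ht h0
  rw [ht, map_zero, h0, Pi.zero_apply, mul_zero]

open scoped LinearPMap in
theorem adjoint_mulOp [CompleteSpace H] (hm : Measurable m) :
    (mulOp V m)† = mulOp V (fun t => starRingEnd ℂ (m t)) := by
  have hdense := dense_mulOp_domain (V := V) hm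
  refine (LinearPMap.eq_of_le_of_domain_eq
    (isFormalAdjoint_mulOp_conj.le_adjoint hdense) (le_antisymm ?_ fun ψ hψ => ?_)).symm
  · exact (isFormalAdjoint_mulOp_conj.le_adjoint hdense).1
  · exact (Lp.memLp (V.symm ((mulOp V m)† ⟨ψ, hψ⟩))).ae_eq
      (coeFn_symm_eq_of_forall_inner_mulOp hm fun φ =>
        LinearPMap.adjoint_isFormalAdjoint hdense ⟨ψ, hψ⟩ φ)

theorem isSelfAdjoint_mulOp_ofReal [CompleteSpace H] {m : α → ℝ} (hm : Measurable m) :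
    IsSelfAdjoint (mulOp V fun t => (m t : ℂ)) := by
  rw [LinearPMap.isSelfAdjoint_def, adjoint_mulOp hm.complex_ofReal]
  simp only [Complex.conj_ofReal]

theorem norm_pow_le_one_add_norm_pow {E : Type*} [SeminormedRing E] (x : E) {j k : ℕ}
    (hjk : j ≤ k) : ‖x‖ ^ j ≤ 1 + ‖x‖ ^ k := by
  rcases le_total ‖x‖ 1 with h | h
  · exact (pow_le_one₀ (norm_nonneg _) h).trans (le_add_of_nonneg_right (by positivity))
  · exact (pow_le_pow_right₀ h hjk).trans (le_add_of_nonneg_left zero_le_one)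

theorem mem_mulOp_domain_of_norm_le {g : α → ℂ} (hg : Measurable g) {c : ℝ}
    (hle : ∀ t, ‖g t‖ ≤ c * (1 + ‖m t‖)) {φ : H} (hφ : φ ∈ (mulOp V m).domain) :
    φ ∈ (mulOp V g).domain := by
  rw [mem_mulOp_domain] at hφ ⊢
  refine (((Lp.memLp (V.symm φ)).norm.add hφ.norm).const_mul c).mono'
    (hg.aestronglyMeasurable.mul (Lp.aestronglyMeasurable _)) (Eventually.of_forall fun t => ?_)
  rw [norm_mul]
  refine (mul_le_mul_of_nonneg_right (hle t) (norm_nonneg _)).trans_eq ?_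
  change _ = c * (‖V.symm φ t‖ + ‖m t * V.symm φ t‖)
  rw [norm_mul]
  ring

theorem mulOp_pow_domain_mono (hm : Measurable m) {j k : ℕ} (hjk : j ≤ k) :
    (mulOp V (m ^ k)).domain ≤ (mulOp V (m ^ j)).domain := fun _ hφ =>
  mem_mulOp_domain_of_norm_le (c := 1) (hm.pow_const j)
    (fun t => by simpa using norm_pow_le_one_add_norm_pow (m t) hjk) hφ

theorem powOp_mulOp (hm : Measurable m) (k : ℕ) : powOp (mulOp V m) k = mulOp V (m ^ k) := by
  induction k with
  | zero =>
    have hone : ∀ φ : H, φ ∈ (mulOp V (m ^ 0)).domain := fun φ =>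
      (Lp.memLp (V.symm φ)).ae_eq (Eventually.of_forall fun t => by simp)
    refine LinearPMap.ext (top_unique fun φ _ => hone φ).symm fun φ h₁ h₂ => ?_
    exact eq_mulOp_of_coeFn_symm (φ := ⟨φ, h₂⟩)
      (Eventually.of_forall fun t => by simp [powOp, ofBounded])
  | succ k ih =>
    have hpow (φ : (mulOp V (m ^ k)).domain) :
        (fun t => m t * V.symm (mulOp V (m ^ k) φ) t) =ᵐ[μ]
          fun t => (m ^ (k + 1)) t * V.symm φ t := by
      filter_upwards [coeFn_symm_mulOp φ] with t ht
      rw [ht, Pi.pow_apply, Pi.pow_apply, pow_succ', mul_assoc]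
    rw [powOp, ih]
    refine LinearPMap.ext (le_antisymm ?_ fun φ hφ => ?_) fun φ h₁ h₂ => ?_
    · rintro φ ⟨hφ, hφ'⟩
      exact (memLp_congr_ae (hpow ⟨φ, hφ⟩)).1 hφ'
    · have hφk := mulOp_pow_domain_mono hm k.le_succ hφ
      exact ⟨hφk, (memLp_congr_ae (hpow ⟨φ, hφk⟩)).2 hφ⟩
    · exact eq_mulOp_of_coeFn_symm (φ := ⟨φ, h₂⟩)
        ((coeFn_symm_mulOp (V := V) (m := m) ⟨_, h₁.2⟩).trans (hpow ⟨φ, h₁.1⟩))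

end MultiplicationOperators

section PolynomialsOfMultiplicationOperators

theorem mem_domain_sum {R E F ι : Type*} [Ring R] [AddCommGroup E] [Module R E]
    [AddCommGroup F] [Module R F] (s : Finset ι) (A : ι → E →ₗ.[R] F) (x : E) :
    x ∈ (∑ i ∈ s, A i).domain ↔ ∀ i ∈ s, x ∈ (A i).domain := by
  classical
  induction s using Finset.induction_on with
  | empty => simp
  | insert i s his ih =>
    rw [Finset.sum_insert his, LinearPMap.add_domain, Submodule.mem_inf, ih,
      Finset.forall_mem_insert]

theorem exists_norm_pow_le_norm_sum {𝕜 : Type*} [NormedField 𝕜] {k : ℕ} {a : ℕ → 𝕜}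
    (ha : a k ≠ 0) :
    ∃ C : ℝ, ∀ x : 𝕜, ‖x‖ ^ k ≤ C * (1 + ‖∑ l ∈ Finset.range (k + 1), a l * x ^ l‖) := by
  set S : ℝ := ∑ l ∈ Finset.range k, ‖a l‖
  have : 0 ≤ S := Finset.sum_nonneg fun _ _ => norm_nonneg _
  have ha' : 0 < ‖a k‖ := norm_pos_iff.2 ha
  set r : ℝ := 1 + 2 * S / ‖a k‖ with hr
  have hr1 : 1 ≤ r := by rw [hr]; linarith [show 0 ≤ 2 * S / ‖a k‖ by positivity]
  refine ⟨r ^ k + 2 / ‖a k‖, fun x => ?_⟩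
  set p : 𝕜 := ∑ l ∈ Finset.range (k + 1), a l * x ^ l with hp
  have hsmall : ‖x‖ ≤ r → ‖x‖ ^ k ≤ r ^ k := fun h => pow_le_pow_left₀ (norm_nonneg x) h k
  have hlarge : r ≤ ‖x‖ → ‖x‖ ^ k ≤ 2 / ‖a k‖ * ‖p‖ := by
    intro h
    have hlower : ‖∑ l ∈ Finset.range k, a l * x ^ l‖ * ‖x‖ ≤ S * ‖x‖ ^ k := by
      rw [Finset.sum_mul]
      refine (mul_le_mul_of_nonneg_right (norm_sum_le _ _) (norm_nonneg x)).trans ?_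
      rw [Finset.sum_mul]
      refine Finset.sum_le_sum fun l hl => ?_
      rw [norm_mul, norm_pow, mul_assoc, ← pow_succ]
      exact mul_le_mul_of_nonneg_left (pow_le_pow_right₀ (hr1.trans h) (Finset.mem_range.1 hl))
        (norm_nonneg _)
    have hX : 0 ≤ ‖x‖ ^ k := by positivity
    have hq : ‖∑ l ∈ Finset.range k, a l * x ^ l‖ ≤ ‖a k‖ / 2 * ‖x‖ ^ k := by
      have hSx : 2 * S ≤ ‖a k‖ * ‖x‖ := by
        rw [hr, ← le_sub_iff_add_le', div_le_iff₀ ha'] at h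
        linarith
      refine le_of_mul_le_mul_right (hlower.trans ?_) (zero_lt_one.trans_le (hr1.trans h))
      nlinarith
    have hlead : ‖a k‖ * ‖x‖ ^ k ≤ ‖p‖ + ‖∑ l ∈ Finset.range k, a l * x ^ l‖ := by
      rw [← norm_pow, ← norm_mul]
      refine (norm_sub_le _ _).trans_eq' ?_
      rw [hp, Finset.sum_range_succ, add_sub_cancel_left]
    rw [div_mul_eq_mul_div, le_div_iff₀ ha']
    linarith
  have : 0 ≤ 2 / ‖a k‖ := by positivity
  have : 0 ≤ r ^ k := by positivity
  rcases le_total ‖x‖ r with h | h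
  · nlinarith [hsmall h, norm_nonneg p]
  · nlinarith [hlarge h, norm_nonneg p]

variable {α : Type*} [MeasurableSpace α] {μ : Measure α}
variable {H : Type*} [NormedAddCommGroup H] [InnerProductSpace ℂ H]
variable {V : Lp ℂ 2 μ ≃ₗᵢ[ℂ] H} {m : α → ℂ}

theorem coeFn_symm_sum_smul_mulOp {ι : Type*} (s : Finset ι) (a : ι → ℂ) (g : ι → α → ℂ)
    (φ : (∑ i ∈ s, a i • mulOp V (g i)).domain) :
    V.symm ((∑ i ∈ s, a i • mulOp V (g i)) φ) =ᵐ[μ]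
      fun t => (∑ i ∈ s, a i * g i t) * V.symm φ t := by
  classical
  induction s using Finset.induction_on with
  | empty =>
    change V.symm 0 =ᵐ[μ] _
    filter_upwards [Lp.coeFn_zero ℂ 2 μ] with t ht
    rw [map_zero, ht, Pi.zero_apply, Finset.sum_empty, zero_mul]
  | insert i s his ih =>
    revert φ
    rw [Finset.sum_insert his]
    simp only [Finset.sum_insert his]
    rintro ⟨φ, hφ⟩
    rw [LinearPMap.add_apply, map_add, LinearPMap.smul_apply, map_smul]
    filter_upwards [Lp.coeFn_add (a i • V.symm (mulOp V (g i) ⟨φ, hφ.1⟩))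
      (V.symm ((∑ i ∈ s, a i • mulOp V (g i)) ⟨φ, hφ.2⟩)),
      Lp.coeFn_smul (a i) (V.symm (mulOp V (g i) ⟨φ, hφ.1⟩)),
      coeFn_symm_mulOp (V := V) ⟨φ, hφ.1⟩, ih ⟨φ, hφ.2⟩] with t hadd hsmul hi hs
    rw [hadd, Pi.add_apply, hsmul, Pi.smul_apply, hi, hs, smul_eq_mul]
    ring

theorem sum_smul_powOp_mulOp (hm : Measurable m) {k : ℕ} {a : ℕ → ℂ} (ha : a k ≠ 0) :
    ∑ l ∈ Finset.range (k + 1), a l • powOp (mulOp V m) l =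
      mulOp V fun t => ∑ l ∈ Finset.range (k + 1), a l * m t ^ l := by
  simp only [powOp_mulOp hm]
  refine LinearPMap.ext (le_antisymm (fun φ hφ => ?_) fun φ hφ => ?_) fun φ h₁ h₂ => ?_
  · exact (Lp.memLp _).ae_eq (coeFn_symm_sum_smul_mulOp _ a (fun l => m ^ l) ⟨φ, hφ⟩)
  · refine (mem_domain_sum _ _ _).2 fun l hl => ?_
    obtain ⟨C, hC⟩ := exists_norm_pow_le_norm_sum ha
    refine mulOp_pow_domain_mono hm (Finset.mem_range_succ_iff.1 hl) ?_
    exact mem_mulOp_domain_of_norm_le (hm.pow_const k)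
      (fun t => by simpa using hC (m t)) hφ
  · exact eq_mulOp_of_coeFn_symm (φ := ⟨φ, h₂⟩)
      (coeFn_symm_sum_smul_mulOp _ a (fun l => m ^ l) ⟨φ, h₁⟩)

end PolynomialsOfMultiplicationOperators

section Law

variable {α : Type*} [MeasurableSpace α] {μ : Measure α}
variable {H : Type*} [NormedAddCommGroup H] [InnerProductSpace ℂ H]

/-- The distribution of the observable `mulOp V m` in the vector state `φ`; its total mass
is `‖φ‖ ^ 2`. -/
noncomputable def law (V : Lp ℂ 2 μ ≃ₗᵢ[ℂ] H) (m : α → ℝ) (φ : H) : Measure ℝ :=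
  (μ.withDensity fun t => ‖V.symm φ t‖ₑ ^ 2).map m

variable {V : Lp ℂ 2 μ ≃ₗᵢ[ℂ] H} {m : α → ℝ}

theorem aemeasurable_enorm_sq_symm (φ : H) : AEMeasurable (fun t => ‖V.symm φ t‖ₑ ^ 2) μ :=
  (Lp.aestronglyMeasurable _).enorm.pow_const 2

theorem lintegral_law (hm : Measurable m) (φ : H) {g : ℝ → ℝ≥0∞} (hg : Measurable g) :
    ∫⁻ s, g s ∂law V m φ = ∫⁻ t, g (m t) * ‖V.symm φ t‖ₑ ^ 2 ∂μ := by
  rw [law, lintegral_map hg hm, lintegral_withDensity_eq_lintegral_mul₀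
    (aemeasurable_enorm_sq_symm φ) (g := fun t => g (m t)) (hg.comp hm).aemeasurable]
  simp only [Pi.mul_apply, mul_comm]

theorem law_univ (hm : Measurable m) (φ : H) : law V m φ Set.univ = ‖φ‖ₑ ^ 2 := by
  rw [← lintegral_one, lintegral_law hm φ measurable_const]
  simp only [one_mul]
  rw [← enorm_sq_eq_lintegral, LinearIsometryEquiv.enorm_map]

theorem isFiniteMeasure_law (hm : Measurable m) (φ : H) : IsFiniteMeasure (law V m φ) :=
  ⟨by rw [law_univ hm]; exact ENNReal.pow_lt_top enorm_lt_top⟩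

variable {g : ℝ → ℂ}

theorem mem_mulOp_comp_domain_iff (hm : Measurable m) (hg : Measurable g) {φ : H} :
    φ ∈ (mulOp V fun t => g (m t)).domain ↔ MemLp g 2 (law V m φ) := by
  rw [mem_mulOp_domain, memLp_two_iff_lintegral_enorm_sq_lt_top (f := fun t => g (m t) * _)
    ((hg.comp hm).aestronglyMeasurable.mul (Lp.aestronglyMeasurable _)),
    memLp_two_iff_lintegral_enorm_sq_lt_top hg.aestronglyMeasurable,
    lintegral_law hm φ (hg.enorm.pow_const 2)]
  simp only [enorm_mul, mul_pow]

theorem enorm_mulOp_comp_sq (hm : Measurable m) (hg : Measurable g)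
    (φ : (mulOp V fun t => g (m t)).domain) :
    ‖mulOp V (fun t => g (m t)) φ‖ₑ ^ 2 = ∫⁻ s, ‖g s‖ₑ ^ 2 ∂law V m φ := by
  rw [← V.symm.enorm_map, enorm_sq_eq_lintegral, lintegral_law hm _ (hg.enorm.pow_const 2)]
  refine lintegral_congr_ae ?_
  filter_upwards [coeFn_symm_mulOp φ] with t ht
  rw [ht, enorm_mul, mul_pow]

theorem inner_self_mulOp_comp (hm : Measurable m) (hg : Measurable g)
    (φ : (mulOp V fun t => g (m t)).domain) :
    ⟪(φ : H), mulOp V (fun t => g (m t)) φ⟫_ℂ = ∫ s, g s ∂law V m φ := by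
  rw [inner_mulOp, law, integral_map hm.aemeasurable hg.aestronglyMeasurable,
    integral_withDensity_eq_integral_toReal_smul₀ (aemeasurable_enorm_sq_symm _)
      (Eventually.of_forall fun t => ENNReal.pow_lt_top enorm_lt_top)]
  refine integral_congr_ae (Eventually.of_forall fun t => ?_)
  simp only [RCLike.inner_apply, mul_assoc, RCLike.mul_conj, ENNReal.toReal_pow, toReal_enorm,
    Complex.real_smul, Complex.coe_algebraMap, Complex.ofReal_pow]
  ring

theorem powOp_mulOp_ofReal (hm : Measurable m) (k : ℕ) :
    powOp (mulOp V fun t => (m t : ℂ)) k = mulOp V fun t => (m t : ℂ) ^ k :=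
  powOp_mulOp hm.complex_ofReal k

theorem mem_powOp_domain_iff (hm : Measurable m) (k : ℕ) {φ : H} :
    φ ∈ (powOp (mulOp V fun t => (m t : ℂ)) k).domain ↔
      MemLp (fun s : ℝ => (s : ℂ) ^ k) 2 (law V m φ) := by
  rw [powOp_mulOp_ofReal hm]
  exact mem_mulOp_comp_domain_iff hm (g := fun s => (s : ℂ) ^ k) (by fun_prop)

theorem enorm_powOp_sq (hm : Measurable m) {k : ℕ}
    (φ : (powOp (mulOp V fun t => (m t : ℂ)) k).domain) :
    ‖powOp (mulOp V fun t => (m t : ℂ)) k φ‖ₑ ^ 2 =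
      ∫⁻ s, ‖(s : ℂ) ^ k‖ₑ ^ 2 ∂law V m φ := by
  revert φ
  rw [powOp_mulOp_ofReal hm]
  exact enorm_mulOp_comp_sq hm (g := fun s => (s : ℂ) ^ k) (by fun_prop)

theorem inner_self_powOp (hm : Measurable m) {k : ℕ}
    (φ : (powOp (mulOp V fun t => (m t : ℂ)) k).domain) :
    ⟪(φ : H), powOp (mulOp V fun t => (m t : ℂ)) k φ⟫_ℂ = ∫ s, (s : ℂ) ^ k ∂law V m φ := by
  revert φ
  rw [powOp_mulOp_ofReal hm]
  exact inner_self_mulOp_comp hm (g := fun s => (s : ℂ) ^ k) (by fun_prop)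

theorem memLp_ofReal_pow_of_le {ρ : Measure ℝ} [IsFiniteMeasure ρ] {j k : ℕ} (hjk : j ≤ k)
    (h : MemLp (fun s : ℝ => (s : ℂ) ^ k) 2 ρ) : MemLp (fun s : ℝ => (s : ℂ) ^ j) 2 ρ := by
  refine ((memLp_const (1 : ℝ)).add h.norm).mono' (by fun_prop) (Eventually.of_forall fun s => ?_)
  simpa only [norm_pow, Pi.add_apply] using norm_pow_le_one_add_norm_pow (s : ℂ) hjk

theorem norm_powOp_sq_le (hm : Measurable m) {j k : ℕ} (hjk : j ≤ k) {φ : H}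
    (hj : φ ∈ (powOp (mulOp V fun t => (m t : ℂ)) j).domain)
    (hk : φ ∈ (powOp (mulOp V fun t => (m t : ℂ)) k).domain) :
    ‖powOp (mulOp V fun t => (m t : ℂ)) j ⟨φ, hj⟩‖ ^ 2 ≤
      ‖φ‖ ^ 2 + ‖powOp (mulOp V fun t => (m t : ℂ)) k ⟨φ, hk⟩‖ ^ 2 := by
  have hle (s : ℝ) : ‖(s : ℂ) ^ j‖ₑ ^ 2 ≤ 1 + ‖(s : ℂ) ^ k‖ₑ ^ 2 := by
    rw [← enorm_pow, ← enorm_pow, ← pow_mul, ← pow_mul, ← ofReal_norm, ← ofReal_norm,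
      norm_pow, norm_pow, ← ENNReal.ofReal_one, ← ENNReal.ofReal_add zero_le_one (by positivity)]
    exact ENNReal.ofReal_le_ofReal
      (norm_pow_le_one_add_norm_pow (s : ℂ) (Nat.mul_le_mul_right 2 hjk))
  have henorm : ‖powOp (mulOp V fun t => (m t : ℂ)) j ⟨φ, hj⟩‖ₑ ^ 2 ≤
      ‖φ‖ₑ ^ 2 + ‖powOp (mulOp V fun t => (m t : ℂ)) k ⟨φ, hk⟩‖ₑ ^ 2 := by
    rw [enorm_powOp_sq hm, enorm_powOp_sq hm, ← law_univ hm, ← lintegral_one,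
      ← lintegral_add_left measurable_const]
    exact lintegral_mono hle
  simp only [← ofReal_norm, ← ENNReal.ofReal_pow (norm_nonneg _)] at henorm
  rwa [← ENNReal.ofReal_add (sq_nonneg _) (sq_nonneg _),
    ENNReal.ofReal_le_ofReal_iff (add_nonneg (sq_nonneg _) (sq_nonneg _))] at henorm

end Law

theorem norm_inner_le_of_isPositive {H : Type*} [NormedAddCommGroup H]
    [InnerProductSpace ℂ H] [CompleteSpace H] {S : H →L[ℂ] H} (hS : S.IsPositive) {a : ℝ}
    (ha : 0 < a) (ψ φ : H) :
    ‖⟪ψ, S φ⟫_ℂ‖ ≤ a * (⟪φ, S φ⟫_ℂ).re + a⁻¹ * (⟪ψ, S ψ⟫_ℂ).re := by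
  set R : H →L[ℂ] H := CFC.sqrt S
  have hS0 : 0 ≤ S := (ContinuousLinearMap.nonneg_iff_isPositive S).2 hS
  have hRR (x y : H) : ⟪x, S y⟫_ℂ = ⟪R x, R y⟫_ℂ := by
    have hsymm : R.IsPositive :=
      (ContinuousLinearMap.nonneg_iff_isPositive R).1 (CFC.sqrt_nonneg S)
    rw [← CFC.sqrt_mul_sqrt_self S hS0]
    exact (hsymm.isSymmetric _ _).symm
  have hsq (x : H) : (⟪R x, R x⟫_ℂ).re = ‖R x‖ ^ 2 := inner_self_eq_norm_sq (𝕜 := ℂ) _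
  rw [hRR, hRR, hRR, hsq, hsq]
  -- AM-GM: `x y ≤ a y² + a⁻¹ x²`
  refine (norm_inner_le_norm _ _).trans ?_
  have hamgm : 0 ≤ a⁻¹ * (a * ‖R φ‖ - ‖R ψ‖) ^ 2 := by positivity
  have hexp : a⁻¹ * (a * ‖R φ‖ - ‖R ψ‖) ^ 2 =
      a * ‖R φ‖ ^ 2 + a⁻¹ * ‖R ψ‖ ^ 2 - 2 * (‖R ψ‖ * ‖R φ‖) := by
    field_simp
    ring
  have : 0 ≤ ‖R ψ‖ * ‖R φ‖ := by positivity
  linarith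

namespace PositiveOperatorMeasure

variable {Ω : Type*} [MeasurableSpace Ω]
variable {H : Type*} [NormedAddCommGroup H] [InnerProductSpace ℂ H]
variable (E : PositiveOperatorMeasure Ω H) {f : Ω → ℂ}

theorem inner_apply_self (B : Set Ω) (φ : H) :
    ⟪φ, E.toFun B φ⟫_ℂ = (⟪φ, E.toFun B φ⟫_ℂ).re :=
  ((E.isPositive B).isSymmetric.coe_re_inner_self_apply φ).symm

theorem re_inner_apply_self_nonneg (B : Set Ω) (φ : H) : 0 ≤ (⟪φ, E.toFun B φ⟫_ℂ).re :=
  (E.isPositive B).re_inner_nonneg_right φ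

/-- The measure `E_{φ,φ} : B ↦ ⟪φ, E(B) φ⟫`. -/
noncomputable def diag (φ : H) : Measure Ω :=
  Measure.ofMeasurable (fun B _ => ENNReal.ofReal (⟪φ, E.toFun B φ⟫_ℂ).re)
    (by simp [E.empty])
    fun B hB hd => by
      have h := Complex.hasSum_re (E.hasSum_inner B hB hd φ φ)
      rw [← h.tsum_eq, ENNReal.ofReal_tsum_of_nonneg
        (fun i => E.re_inner_apply_self_nonneg (B i) φ) h.summable]

theorem diag_apply (φ : H) {B : Set Ω} (hB : MeasurableSet B) :
    E.diag φ B = ENNReal.ofReal (⟪φ, E.toFun B φ⟫_ℂ).re :=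
  Measure.ofMeasurable_apply B hB

instance (φ : H) : IsFiniteMeasure (E.diag φ) :=
  ⟨by rw [E.diag_apply φ MeasurableSet.univ]; exact ENNReal.ofReal_lt_top⟩

theorem scalar_self_apply (φ : H) {B : Set Ω} (hB : MeasurableSet B) :
    E.scalar φ φ B = (E.diag φ).real B := by
  rw [scalar_apply, inner_apply_self, measureReal_def, E.diag_apply φ hB,
    ENNReal.toReal_ofReal (E.re_inner_apply_self_nonneg B φ)]

theorem diag_le_variation (φ : H) : E.diag φ ≤ (E.scalar φ φ).variation := by
  refine Measure.le_intro fun B hB _ => ?_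
  refine le_trans (le_of_eq ?_) (VectorMeasure.enorm_measure_le_variation (E.scalar φ φ) B)
  rw [E.scalar_self_apply φ hB, ← ofReal_norm, Complex.norm_real, ofReal_norm,
    Real.enorm_of_nonneg measureReal_nonneg, ofReal_measureReal]

theorem integral_self_eq (hf : Measurable f) {φ : H} (hφ : φ ∈ E.domain f) :
    E.integral f φ φ = ∫ z, f z ∂E.diag φ := by
  have hint : Integrable f (E.diag φ) := (hφ φ).mono_measure (E.diag_le_variation φ)
  refine tendsto_nhds_unique (integral_eq_lim hf (hφ φ)) ?_
  refine (tendsto_integral_approxOn_of_measurable_of_range_subset hf hint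
    (Set.range f ∪ {0}) subset_rfl).congr fun n => ?_
  have hn := SimpleFunc.integrable_approxOn_range hf hint n
  rw [SimpleFunc.integral_eq_integral _ hn, SimpleFunc.integral_eq_sum _ hn]
  refine Finset.sum_congr rfl fun c _ => ?_
  rw [E.scalar_self_apply φ (SimpleFunc.measurableSet_preimage _ _), Complex.real_smul, mul_comm]

variable [CompleteSpace H]

theorem isFormalAdjoint_operatorIntegral (hf : Measurable f)
    (hreal : ∀ z, starRingEnd ℂ (f z) = f z) :
    (E.operatorIntegral hf).IsFormalAdjoint (E.operatorIntegral hf) := by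
  intro ψ φ
  have hconj (B : Set Ω) : starRingEnd ℂ (E.scalar φ ψ B) = E.scalar ψ φ B := by
    rw [scalar_apply, scalar_apply, inner_conj_symm]
    exact (E.isPositive B).isSymmetric _ _
  rw [← inner_conj_symm, inner_operatorIntegral, inner_operatorIntegral]
  refine tendsto_nhds_unique ?_ (integral_eq_lim hf (φ.2 ψ))
  refine ((Complex.continuous_conj.tendsto _).comp (integral_eq_lim hf (ψ.2 φ))).congr fun n => ?_
  rw [Function.comp_apply, map_sum]
  refine Finset.sum_congr rfl fun c hc => ?_
  obtain ⟨z, rfl⟩ := SimpleFunc.mem_range.1 hc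
  rw [map_mul, hconj]
  congr 1
  rcases SimpleFunc.approxOn_mem hf (s := Set.range f ∪ {0}) (y₀ := 0) (by simp) n z
    with ⟨w, hw⟩ | h0
  · rw [← hw, hreal]
  · rw [Set.mem_singleton_iff.1 h0, map_zero]

theorem variation_scalar_le {c : ℝ≥0∞} (hc : c ≠ 0) (hc' : c ≠ ∞) (ψ φ : H) :
    (E.scalar ψ φ).variation ≤ c • E.diag φ + c⁻¹ • E.diag ψ := by
  lift c to NNReal using hc'
  have hpos : (0 : ℝ) < c := NNReal.coe_pos.2 (pos_iff_ne_zero.2 (ENNReal.coe_ne_zero.1 hc))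
  refine VectorMeasure.variation_le_of_forall_enorm_le fun B hB => ?_
  rw [Measure.add_apply, Measure.smul_apply, Measure.smul_apply, E.diag_apply φ hB,
    E.diag_apply ψ hB, scalar_apply, smul_eq_mul, smul_eq_mul, ← ENNReal.ofReal_coe_nnreal,
    ← ENNReal.ofReal_inv_of_pos hpos, ← ENNReal.ofReal_mul hpos.le,
    ← ENNReal.ofReal_mul (inv_nonneg.2 hpos.le), ← ofReal_norm]
  refine (ENNReal.ofReal_le_ofReal (norm_inner_le_of_isPositive (E.isPositive B) hpos ψ φ)).trans
    ENNReal.ofReal_add_le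

-- On a level set `{g = c}` of a simple function, `c |E_{ψ,φ}| ≤ c² E_{φ,φ} + E_{ψ,ψ}`.
theorem lintegral_variation_scalar_le {g : Ω → ℝ≥0∞} (hg : ∀ z, g z ≠ ∞) (ψ φ : H) :
    ∫⁻ z, g z ∂(E.scalar ψ φ).variation ≤ ∫⁻ z, g z ^ 2 ∂E.diag φ + E.diag ψ Set.univ := by
  rw [lintegral]
  refine iSup₂_le fun s hs => ?_
  calc s.lintegral (E.scalar ψ φ).variation
      ≤ ∑ c ∈ s.range, (c ^ 2 * E.diag φ (s ⁻¹' {c}) + E.diag ψ (s ⁻¹' {c})) := by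
        refine Finset.sum_le_sum fun c hc => ?_
        obtain ⟨z, rfl⟩ := SimpleFunc.mem_range.1 hc
        have htop : s z ≠ ∞ := ((hs z).trans_lt (hg z).lt_top).ne
        rcases eq_or_ne (s z) 0 with h0 | h0
        · simp [h0]
        · refine (mul_le_mul_right (E.variation_scalar_le h0 htop ψ φ _) _).trans_eq ?_
          simp only [Measure.add_apply, Measure.smul_apply, smul_eq_mul, mul_add, ← mul_assoc,
            ENNReal.mul_inv_cancel h0 htop, one_mul, sq]
    _ = (s.map fun c => c ^ 2).lintegral (E.diag φ) + E.diag ψ Set.univ := by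
        rw [Finset.sum_add_distrib, SimpleFunc.map_lintegral,
          s.sum_range_measure_preimage_singleton]
    _ ≤ ∫⁻ z, g z ^ 2 ∂E.diag φ + E.diag ψ Set.univ := by
        rw [← SimpleFunc.lintegral_eq_lintegral]
        gcongr with z
        exact pow_le_pow_left₀ zero_le (hs z) 2

theorem mem_domain_of_memLp_diag (hf : Measurable f) {φ : H}
    (h : MemLp f 2 (E.diag φ)) :
    φ ∈ E.domain f := by
  refine fun ψ => ⟨hf.aestronglyMeasurable, ?_⟩
  refine (E.lintegral_variation_scalar_le (fun z => enorm_ne_top) ψ φ).trans_lt ?_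
  exact ENNReal.add_lt_top.2 ⟨(memLp_two_iff_lintegral_enorm_sq_lt_top h.1).1 h,
    measure_lt_top _ _⟩

end PositiveOperatorMeasure

section SmearedMoments

theorem integral_sub_pow {ρ : Measure ℝ} [IsFiniteMeasure ρ] {k : ℕ}
    (hρ : MemLp (fun s : ℝ => (s : ℂ) ^ k) 2 ρ) (t : ℝ) :
    ((∫ s, (t - s) ^ k ∂ρ : ℝ) : ℂ) = ∑ l ∈ Finset.range (k + 1),
      ((k.choose l : ℂ) * (-1) ^ (k - l) * ∫ s : ℝ, (s : ℂ) ^ (k - l) ∂ρ) * (t : ℂ) ^ l := by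
  have hexpand (s : ℝ) : (((t - s) ^ k : ℝ) : ℂ) = ∑ l ∈ Finset.range (k + 1),
      ((k.choose l : ℂ) * (-1) ^ (k - l) * (s : ℂ) ^ (k - l)) * (t : ℂ) ^ l := by
    push_cast
    rw [sub_eq_add_neg, add_pow]
    refine Finset.sum_congr rfl fun l _ => ?_
    rw [neg_pow (s : ℂ)]
    ring
  have hint (l : ℕ) : Integrable (fun s : ℝ => (s : ℂ) ^ (k - l)) ρ :=
    (memLp_ofReal_pow_of_le (k.sub_le l) hρ).integrable one_le_two
  rw [← integral_complex_ofReal]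
  simp only [hexpand]
  rw [integral_finsetSum _ fun l _ => ((hint l).const_mul _).mul_const _]
  simp only [integral_mul_const, integral_const_mul]

theorem memLp_sub_pow_prod {ν ρ : Measure ℝ} [IsFiniteMeasure ν] [IsFiniteMeasure ρ] {k : ℕ}
    (hν : MemLp (fun s : ℝ => (s : ℂ) ^ k) 2 ν) (hρ : MemLp (fun s : ℝ => (s : ℂ) ^ k) 2 ρ) :
    MemLp (fun p : ℝ × ℝ => ((p.1 - p.2 : ℝ) : ℂ) ^ k) 2 (ν.prod ρ) := by
  refine (((hν.comp_fst ρ).norm.add (hρ.comp_snd ν).norm).const_mul (2 ^ (k - 1))).mono'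
    (by fun_prop) (Eventually.of_forall fun p => ?_)
  simp only [Pi.add_apply, norm_pow, Complex.norm_real]
  exact (pow_le_pow_left₀ (norm_nonneg _) (norm_sub_le _ _) k).trans
    (add_pow_le (norm_nonneg _) (norm_nonneg _) k)

variable {α : Type*} [MeasurableSpace α] {μ : Measure α}
variable {H : Type*} [NormedAddCommGroup H] [InnerProductSpace ℂ H]
variable {V : Lp ℂ 2 μ ≃ₗᵢ[ℂ] H} {m : α → ℝ}
variable {Ω : Type*} [MeasurableSpace Ω] {E : PositiveOperatorMeasure Ω H} {x : Ω → ℝ}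
variable {ρ : Measure ℝ} [IsFiniteMeasure ρ] {k : ℕ}

theorem sum_smul_powOp_eq_mulOp_integral [NeZero ρ] (hm : Measurable m)
    (hρ : MemLp (fun s : ℝ => (s : ℂ) ^ k) 2 ρ) :
    ∑ l ∈ Finset.range (k + 1), ((k.choose l : ℂ) * (-1) ^ (k - l) *
        ∫ s : ℝ, (s : ℂ) ^ (k - l) ∂ρ) • powOp (mulOp V fun t => (m t : ℂ)) l =
      mulOp V fun t => ((∫ s, (m t - s) ^ k ∂ρ : ℝ) : ℂ) := by
  have hlead : (k.choose k : ℂ) * (-1) ^ (k - k) * ∫ s : ℝ, (s : ℂ) ^ (k - k) ∂ρ ≠ 0 := by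
    simpa [measureReal_eq_zero_iff] using NeZero.ne ρ
  rw [sum_smul_powOp_mulOp hm.complex_ofReal
    (a := fun l => (k.choose l : ℂ) * (-1) ^ (k - l) * ∫ s : ℝ, (s : ℂ) ^ (k - l) ∂ρ) hlead]
  simp only [integral_sub_pow hρ]

theorem memLp_pow_diag (hm : Measurable m) (hx : Measurable x)
    (hρ : MemLp (fun s : ℝ => (s : ℂ) ^ k) 2 ρ) {φ : H}
    (hE : (E.diag φ).map x = ((law V m φ).prod ρ).map fun p => p.1 - p.2)
    (hφ : φ ∈ (powOp (mulOp V fun t => (m t : ℂ)) k).domain) :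
    MemLp (fun z => (x z : ℂ) ^ k) 2 (E.diag φ) := by
  have := isFiniteMeasure_law (V := V) hm φ
  have hpow : AEStronglyMeasurable (fun s : ℝ => (s : ℂ) ^ k) ((E.diag φ).map x) := by fun_prop
  refine (memLp_map_measure_iff hpow hx.aemeasurable).1 ?_
  rw [hE] at hpow ⊢
  exact (memLp_map_measure_iff hpow (by fun_prop)).2
    (memLp_sub_pow_prod ((mem_powOp_domain_iff hm k).1 hφ) hρ)

theorem integral_pow_diag (hm : Measurable m) (hx : Measurable x)
    (hρ : MemLp (fun s : ℝ => (s : ℂ) ^ k) 2 ρ) {φ : H}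
    (hE : (E.diag φ).map x = ((law V m φ).prod ρ).map fun p => p.1 - p.2)
    (hφ : φ ∈ (powOp (mulOp V fun t => (m t : ℂ)) k).domain) :
    ∫ z, (x z : ℂ) ^ k ∂E.diag φ = ∫ t, ((∫ s, (t - s) ^ k ∂ρ : ℝ) : ℂ) ∂law V m φ := by
  have := isFiniteMeasure_law (V := V) hm φ
  have hpow : Continuous fun s : ℝ => (s : ℂ) ^ k := by fun_prop
  rw [← integral_map (f := fun s : ℝ => (s : ℂ) ^ k) hx.aemeasurable hpow.aestronglyMeasurable,
    hE, integral_map (by fun_prop) hpow.aestronglyMeasurable, integral_prod _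
      ((memLp_sub_pow_prod ((mem_powOp_domain_iff hm k).1 hφ) hρ).integrable one_le_two)]
  simp only [← Complex.ofReal_pow, integral_complex_ofReal]

variable [CompleteSpace H]

theorem operatorIntegral_pow_eq_sum_smul_powOp [NeZero ρ] (hm : Measurable m) (hx : Measurable x)
    (hρ : MemLp (fun s : ℝ => (s : ℂ) ^ k) 2 ρ)
    (hE : ∀ φ, (E.diag φ).map x = ((law V m φ).prod ρ).map fun p => p.1 - p.2)
    (hxk : Measurable fun z => (x z : ℂ) ^ k) :
    E.operatorIntegral hxk = ∑ l ∈ Finset.range (k + 1), ((k.choose l : ℂ) * (-1) ^ (k - l) *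
      ∫ s : ℝ, (s : ℂ) ^ (k - l) ∂ρ) • powOp (mulOp V fun t => (m t : ℂ)) l := by
  have hsum := sum_smul_powOp_eq_mulOp_integral (V := V) hm hρ
  have hg : Measurable fun t : ℝ => ∫ s, (t - s) ^ k ∂ρ :=
    (StronglyMeasurable.integral_prod_right (f := fun t s => (t - s) ^ k)
      (Continuous.stronglyMeasurable (by fun_prop))).measurable
  have hpow {φ : H} (hφ : φ ∈ (mulOp V fun t => ((∫ s, (m t - s) ^ k ∂ρ : ℝ) : ℂ)).domain) :
      φ ∈ (powOp (mulOp V fun t => (m t : ℂ)) k).domain := by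
    rw [← hsum] at hφ
    exact (mem_domain_sum _ _ _).1 hφ k (Finset.self_mem_range_succ k)
  rw [hsum]
  refine eq_of_isSelfAdjoint_of_le (isSelfAdjoint_mulOp_ofReal (hg.comp hm))
    (E.isFormalAdjoint_operatorIntegral hxk fun z => by rw [map_pow, Complex.conj_ofReal])
    (le_of_inner_self_eq (dense_mulOp_domain (hg.comp hm).complex_ofReal) (fun φ hφ =>
      E.mem_domain_of_memLp_diag hxk (memLp_pow_diag hm hx hρ (hE φ) (hpow hφ))) fun φ => ?_)
  rw [E.inner_operatorIntegral hxk, E.integral_self_eq hxk,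
    integral_pow_diag hm hx hρ (hE φ) (hpow φ.2)]
  · exact (inner_self_mulOp_comp hm hg.complex_ofReal φ).symm
  · exact E.mem_domain_of_memLp_diag hxk (memLp_pow_diag hm hx hρ (hE φ) (hpow φ.2))

end SmearedMoments

section WeakIntegrals

variable {Ω : Type*} [MeasurableSpace Ω] {μ : Measure Ω}
variable {H K : Type*} [NormedAddCommGroup H] [InnerProductSpace ℂ H]
variable [NormedAddCommGroup K] [InnerProductSpace ℂ K]

theorem integrable_inner_of_memLp_two {f g : Ω → K} (hf : MemLp f 2 μ) (hg : MemLp g 2 μ) :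
    Integrable (fun z => ⟪f z, g z⟫_ℂ) μ := by
  refine (L2.integrable_inner (𝕜 := ℂ) hf.toLp hg.toLp).congr ?_
  filter_upwards [hf.coeFn_toLp, hg.coeFn_toLp] with z h₁ h₂
  rw [h₁, h₂]

theorem diag_eq_withDensity {E : PositiveOperatorMeasure Ω H} {φ : H} {g : Ω → K}
    (hg : MemLp g 2 μ)
    (hE : ∀ B, MeasurableSet B → ⟪φ, E.toFun B φ⟫_ℂ = ∫ z in B, ⟪g z, g z⟫_ℂ ∂μ) :
    E.diag φ = μ.withDensity fun z => ‖g z‖ₑ ^ 2 := by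
  ext B hB
  have hsq : ∫ z in B, ⟪g z, g z⟫_ℂ ∂μ = ((∫ z in B, ‖g z‖ ^ 2 ∂μ : ℝ) : ℂ) := by
    rw [← integral_complex_ofReal]
    simp only [inner_self_eq_norm_sq_to_K, Complex.coe_algebraMap, Complex.ofReal_pow]
  rw [E.diag_apply φ hB, hE B hB, hsq, Complex.ofReal_re, withDensity_apply _ hB,
    ofReal_integral_eq_lintegral_ofReal (hg.integrable_norm_pow two_ne_zero).integrableOn
      (Eventually.of_forall fun z => sq_nonneg _)]
  simp only [ENNReal.ofReal_pow (norm_nonneg _), ofReal_norm]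

variable [CompleteSpace H] [CompleteSpace K] {G : Ω → H →L[ℂ] K}

-- By the closed graph theorem: an `L²`-limit is an almost everywhere limit along a subsequence.
theorem exists_continuousLinearMap_coeFn_eq (hG : ∀ φ, MemLp (fun z => G z φ) 2 μ) :
    ∃ J : H →L[ℂ] Lp K 2 μ, ∀ φ, J φ =ᵐ[μ] fun z => G z φ := by
  let J : H →ₗ[ℂ] Lp K 2 μ :=
    { toFun := fun φ => (hG φ).toLp
      map_add' := fun φ ψ => by
        rw [← MemLp.toLp_add]
        exact MemLp.toLp_congr _ _ (Eventually.of_forall fun z => map_add (G z) φ ψ)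
      map_smul' := fun c φ => by
        rw [RingHom.id_apply, ← MemLp.toLp_const_smul]
        exact MemLp.toLp_congr _ _ (Eventually.of_forall fun z => map_smul (G z) c φ) }
  have hJ (φ : H) : J φ =ᵐ[μ] fun z => G z φ := (hG φ).coeFn_toLp
  refine ⟨⟨J, J.continuous_of_seq_closed_graph fun u φ g hu hg => ?_⟩, hJ⟩
  obtain ⟨ns, hns, hlim⟩ := (tendstoInMeasure_of_tendsto_Lp hg).exists_seq_tendsto_ae
  refine Lp.ext ?_
  filter_upwards [hlim, hJ φ, ae_all_iff.2 fun n => hJ (u n)] with z hz hφ hun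
  refine tendsto_nhds_unique hz ?_
  simp only [Function.comp_apply, hun, hφ]
  exact ((G z).continuous.tendsto φ).comp (hu.comp hns.tendsto_atTop)

theorem exists_isPositive_inner_eq_integral (hG : ∀ φ, MemLp (fun z => G z φ) 2 μ) :
    ∃ S : H →L[ℂ] H, S.IsPositive ∧ ∀ ψ φ, ⟪ψ, S φ⟫_ℂ = ∫ z, ⟪G z ψ, G z φ⟫_ℂ ∂μ := by
  obtain ⟨J, hJ⟩ := exists_continuousLinearMap_coeFn_eq hG
  refine ⟨J.adjoint ∘L J, ContinuousLinearMap.isPositive_adjoint_comp_self J, fun ψ φ => ?_⟩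
  rw [ContinuousLinearMap.comp_apply, ContinuousLinearMap.adjoint_inner_right, L2.inner_def]
  refine integral_congr_ae ?_
  filter_upwards [hJ ψ, hJ φ] with z hψ hφ
  rw [hψ, hφ]

open scoped Classical in
theorem exists_positiveOperatorMeasure_inner_eq_setIntegral
    (hG : ∀ φ, MemLp (fun z => G z φ) 2 μ) :
    ∃ E : PositiveOperatorMeasure Ω H, ∀ B, MeasurableSet B → ∀ ψ φ,
      ⟪ψ, E.toFun B φ⟫_ℂ = ∫ z in B, ⟪G z ψ, G z φ⟫_ℂ ∂μ := by
  choose S hSpos hS using fun B : Set Ω =>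
    exists_isPositive_inner_eq_integral fun φ => (hG φ).restrict B
  let F : Set Ω → H →L[ℂ] H := fun B => if MeasurableSet B then S B else 0
  have hF {B : Set Ω} (hB : MeasurableSet B) (ψ φ : H) :
      ⟪ψ, F B φ⟫_ℂ = ∫ z in B, ⟪G z ψ, G z φ⟫_ℂ ∂μ := by
    rw [← hS, show F B = S B from if_pos hB]
  have hint (ψ φ : H) : Integrable (fun z => ⟪G z ψ, G z φ⟫_ℂ) μ :=
    integrable_inner_of_memLp_two (hG ψ) (hG φ)
  refine ⟨{ toFun := F
            isPositive := fun B => ?_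
            not_measurable := fun B hB => if_neg hB
            empty := ?_
            hasSum_inner := fun B hB hd ψ φ => ?_ }, fun B hB => hF hB⟩
  · by_cases hB : MeasurableSet B
    · simpa only [F, if_pos hB] using hSpos B
    · simpa only [F, if_neg hB] using ContinuousLinearMap.isPositive_zero
  · ext φ
    refine ext_inner_left ℂ fun ψ => ?_
    rw [hF MeasurableSet.empty, setIntegral_empty, zero_apply, inner_zero_right]
  · simp only [hF (hB _), hF (MeasurableSet.iUnion hB)]
    exact hasSum_integral_iUnion hB hd (hint ψ φ).integrableOn

end WeakIntegrals

section HilbertBasis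

variable {𝕜 ι κ H K : Type*} [RCLike 𝕜] [NormedAddCommGroup H] [InnerProductSpace 𝕜 H]
  [NormedAddCommGroup K] [InnerProductSpace 𝕜 K]

theorem summable_norm_sq_iff_tsum_enorm_sq_ne_top (f : ι → H) :
    Summable (fun i => ‖f i‖ ^ 2) ↔ ∑' i, ‖f i‖ₑ ^ 2 ≠ ∞ := by
  have h := ENNReal.tsum_coe_ne_top_iff_summable_coe (f := fun i => ‖f i‖₊ ^ 2)
  simp only [ENNReal.coe_pow, NNReal.coe_pow, coe_nnnorm] at h
  exact h.symm

theorem hasSum_norm_inner_sq (b : HilbertBasis ι 𝕜 H) (x : H) :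
    HasSum (fun i => ‖⟪b i, x⟫_𝕜‖ ^ 2) (‖x‖ ^ 2) := by
  have h := (b.hasSum_inner_mul_inner x x).mapL RCLike.reCLM
  simpa only [inner_mul_symm_re_eq_norm, RCLike.reCLM_apply, norm_mul, norm_inner_symm x, ← sq,
    inner_self_eq_norm_sq] using h

theorem tsum_enorm_inner_sq (b : HilbertBasis ι 𝕜 H) (x : H) :
    ∑' i, ‖⟪b i, x⟫_𝕜‖ₑ ^ 2 = ‖x‖ₑ ^ 2 := by
  have h := hasSum_norm_inner_sq b x
  simp only [← ofReal_norm, ← ENNReal.ofReal_pow (norm_nonneg _)]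
  rw [← h.tsum_eq, ENNReal.ofReal_tsum_of_nonneg (fun i => by positivity) h.summable]

theorem countable_of_hilbertBasis [TopologicalSpace.SeparableSpace H] (b : HilbertBasis ι 𝕜 H) :
    Countable ι := by
  refine Pairwise.countable_of_isOpen_disjoint (s := fun i => Metric.ball (b i) (1 / 2)) ?_
    (fun i => Metric.isOpen_ball) fun i => ⟨b i, Metric.mem_ball_self (by norm_num)⟩
  intro i j hij
  refine Metric.ball_disjoint_ball ?_
  have hdist : ‖b i - b j‖ ^ 2 = 2 := by
    rw [@norm_sub_sq 𝕜, b.orthonormal.1 i, b.orthonormal.1 j, b.orthonormal.2 hij]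
    norm_num
  rw [dist_eq_norm]
  nlinarith [norm_nonneg (b i - b j)]

theorem summable_norm_inner_apply_sq (b : HilbertBasis ι 𝕜 H) (b' : HilbertBasis κ 𝕜 K)
    {S : H →L[𝕜] K} (hS : Summable fun i => ‖S (b i)‖ ^ 2) :
    Summable fun p : ι × κ => ‖⟪b' p.2, S (b p.1)⟫_𝕜‖ ^ 2 := by
  refine (summable_prod_of_nonneg fun p => sq_nonneg _).2
    ⟨fun i => (hasSum_norm_inner_sq b' (S (b i))).summable, ?_⟩
  simpa only [fun i => (hasSum_norm_inner_sq b' (S (b i))).tsum_eq] using hS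

variable [CompleteSpace H] [CompleteSpace K]

theorem tsum_enorm_adjoint_sq (b : HilbertBasis ι 𝕜 H) (b' : HilbertBasis κ 𝕜 K)
    (S : H →L[𝕜] K) :
    ∑' j, ‖ContinuousLinearMap.adjoint S (b' j)‖ₑ ^ 2 = ∑' i, ‖S (b i)‖ₑ ^ 2 := by
  simp_rw [← tsum_enorm_inner_sq b, ← tsum_enorm_inner_sq b']
  rw [ENNReal.tsum_comm]
  refine tsum_congr fun i => tsum_congr fun j => ?_
  rw [ContinuousLinearMap.adjoint_inner_right, ← inner_conj_symm, RCLike.enorm_conj]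

theorem summable_norm_adjoint_sq (b : HilbertBasis ι 𝕜 H) (b' : HilbertBasis κ 𝕜 K)
    {S : H →L[𝕜] K} (hS : Summable fun i => ‖S (b i)‖ ^ 2) :
    Summable fun j => ‖ContinuousLinearMap.adjoint S (b' j)‖ ^ 2 := by
  rw [summable_norm_sq_iff_tsum_enorm_sq_ne_top] at hS ⊢
  rwa [tsum_enorm_adjoint_sq b b']

theorem tsum_inner_adjoint (b : HilbertBasis ι 𝕜 H) (b' : HilbertBasis κ 𝕜 K) {X Y : H →L[𝕜] K}
    (hX : Summable fun i => ‖X (b i)‖ ^ 2) (hY : Summable fun i => ‖Y (b i)‖ ^ 2) :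
    ∑' j, ⟪ContinuousLinearMap.adjoint Y (b' j), ContinuousLinearMap.adjoint X (b' j)⟫_𝕜 =
      ∑' i, ⟪X (b i), Y (b i)⟫_𝕜 := by
  let f : ι → κ → 𝕜 := fun i j => ⟪X (b i), b' j⟫_𝕜 * ⟪b' j, Y (b i)⟫_𝕜
  have hf : Summable (Function.uncurry f) := by
    refine Summable.of_norm_bounded ((summable_norm_inner_apply_sq b b' hX).add
      (summable_norm_inner_apply_sq b b' hY)) fun p => ?_
    change ‖⟪X (b p.1), b' p.2⟫_𝕜 * ⟪b' p.2, Y (b p.1)⟫_𝕜‖ ≤ _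
    rw [norm_mul, norm_inner_symm]
    nlinarith [sq_nonneg (‖⟪b' p.2, X (b p.1)⟫_𝕜‖ - ‖⟪b' p.2, Y (b p.1)⟫_𝕜‖),
      sq_nonneg ‖⟪b' p.2, X (b p.1)⟫_𝕜‖, sq_nonneg ‖⟪b' p.2, Y (b p.1)⟫_𝕜‖]
  calc ∑' j, ⟪ContinuousLinearMap.adjoint Y (b' j), ContinuousLinearMap.adjoint X (b' j)⟫_𝕜
      = ∑' j, ∑' i, f i j := by
        refine tsum_congr fun j => ?_
        rw [← b.tsum_inner_mul_inner]
        refine tsum_congr fun i => ?_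
        rw [ContinuousLinearMap.adjoint_inner_left, ContinuousLinearMap.adjoint_inner_right,
          mul_comm]
    _ = ∑' i, ∑' j, f i j := hf.tsum_comm
    _ = ∑' i, ⟪X (b i), Y (b i)⟫_𝕜 := tsum_congr fun i => b'.tsum_inner_mul_inner _ _

end HilbertBasis

section TraceClass

theorem exists_comp_eq_of_norm_le {𝕜 E F G : Type*} [RCLike 𝕜] [NormedAddCommGroup E]
    [NormedSpace 𝕜 E] [NormedAddCommGroup F] [NormedSpace 𝕜 F] [CompleteSpace F]
    [NormedAddCommGroup G] [InnerProductSpace 𝕜 G] [CompleteSpace G]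
    {A : E →L[𝕜] F} {B : E →L[𝕜] G} {c : ℝ} (h : ∀ x, ‖A x‖ ≤ c * ‖B x‖) :
    ∃ D : G →L[𝕜] F, D ∘L B = A := by
  let K : Submodule 𝕜 G := B.range.topologicalClosure
  have hBK : ∀ x, B x ∈ K := fun x => B.range.le_topologicalClosure ⟨x, rfl⟩
  let e : E →ₗ[𝕜] K := (B : E →ₗ[𝕜] G).codRestrict K hBK
  have he : DenseRange e := by
    rw [DenseRange, Subtype.dense_iff, ← Set.range_comp]
    exact fun _ => id
  refine ⟨(A : E →ₗ[𝕜] F).extendOfNorm e ∘L K.orthogonalProjectionOnto, ?_⟩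
  ext x
  have hproj : K.orthogonalProjectionOnto (B x) = e x :=
    Submodule.orthogonalProjectionOnto_mem_subspace_eq_self (⟨B x, hBK x⟩ : K)
  rw [ContinuousLinearMap.comp_apply, ContinuousLinearMap.comp_apply, hproj]
  exact LinearMap.extendOfNorm_eq he ⟨c, h⟩ x

variable {H : Type*} [NormedAddCommGroup H] [InnerProductSpace ℂ H] [CompleteSpace H]

theorem norm_cfcAbs_apply (C : H →L[ℂ] H) (x : H) : ‖CFC.abs C x‖ = ‖C x‖ := by
  have hsymm : (CFC.abs C).IsSymmetric :=
    ((ContinuousLinearMap.nonneg_iff_isPositive _).1 (CFC.abs_nonneg C)).isSymmetric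
  have hinner : ⟪CFC.abs C x, CFC.abs C x⟫_ℂ = ⟪C x, C x⟫_ℂ := calc
    ⟪CFC.abs C x, CFC.abs C x⟫_ℂ = ⟪x, (CFC.abs C * CFC.abs C) x⟫_ℂ := hsymm x _
    _ = ⟪C x, C x⟫_ℂ := by
      rw [CFC.abs_mul_abs]
      exact ContinuousLinearMap.adjoint_inner_right C x (C x)
  rw [inner_self_eq_norm_sq_to_K, inner_self_eq_norm_sq_to_K] at hinner
  exact (sq_eq_sq₀ (norm_nonneg _) (norm_nonneg _)).1 (mod_cast hinner)

theorem isHilbertSchmidt_ofBounded_iff {S : H →L[ℂ] H} :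
    IsHilbertSchmidt (ofBounded S) ↔ Summable fun i => ‖S (onb H i)‖ ^ 2 :=
  ⟨fun ⟨_, h, hS⟩ => ofBounded_injective h ▸ hS, fun h => ⟨S, rfl, h⟩⟩

theorem IsHilbertSchmidt.adjoint {S : H →L[ℂ] H} (hS : IsHilbertSchmidt (ofBounded S)) :
    IsHilbertSchmidt (ofBounded (ContinuousLinearMap.adjoint S)) :=
  isHilbertSchmidt_ofBounded_iff.2
    (summable_norm_adjoint_sq (onb H) (onb H) (isHilbertSchmidt_ofBounded_iff.1 hS))

theorem IsHilbertSchmidt.comp_left {S : H →L[ℂ] H} (hS : IsHilbertSchmidt (ofBounded S))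
    (D : H →L[ℂ] H) : IsHilbertSchmidt (ofBounded (D ∘L S)) := by
  rw [isHilbertSchmidt_ofBounded_iff] at hS ⊢
  refine Summable.of_nonneg_of_le (fun i => by positivity) (fun i => ?_) (hS.mul_left (‖D‖ ^ 2))
  rw [← mul_pow]
  gcongr
  exact D.le_opNorm _

/-- The polar decomposition is replaced by a factorization `|B S| = D B S`, which exhibits `|B S|`
as the product of the Hilbert-Schmidt operators `D B` and `S`. -/
theorem IsHilbertSchmidt.isTraceClass_comp {B S : H →L[ℂ] H}
    (hB : IsHilbertSchmidt (ofBounded B)) (hS : IsHilbertSchmidt (ofBounded S)) :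
    IsTraceClass (ofBounded (B ∘L S)) := by
  refine ⟨B ∘L S, rfl, ?_⟩
  obtain ⟨D, hD⟩ := exists_comp_eq_of_norm_le (A := CFC.abs (B ∘L S)) (B := B ∘L S) (c := 1)
    fun x => by rw [norm_cfcAbs_apply, one_mul]
  have hDB := isHilbertSchmidt_ofBounded_iff.1 (hB.comp_left D).adjoint
  refine Summable.of_norm_bounded (hDB.add (isHilbertSchmidt_ofBounded_iff.1 hS)) fun i => ?_
  have hinner : ⟪(onb H i : H), CFC.abs (B ∘L S) (onb H i)⟫_ℂ =
      ⟪ContinuousLinearMap.adjoint (D ∘L B) (onb H i), S (onb H i)⟫_ℂ := by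
    rw [← hD, ContinuousLinearMap.adjoint_inner_left]
    rfl
  rw [hinner]
  have hCS := (Complex.abs_re_le_norm _).trans (norm_inner_le_norm (𝕜 := ℂ)
    (ContinuousLinearMap.adjoint (D ∘L B) (onb H i)) (S (onb H i)))
  rw [Real.norm_eq_abs]
  nlinarith [sq_nonneg (‖ContinuousLinearMap.adjoint (D ∘L B) (onb H i)‖ - ‖S (onb H i)‖),
    sq_nonneg ‖ContinuousLinearMap.adjoint (D ∘L B) (onb H i)‖, sq_nonneg ‖S (onb H i)‖]

theorem trace_ofBounded (X : H →L[ℂ] H) :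
    trace (ofBounded X) = ∑' i, ⟪(onb H i : H), X (onb H i)⟫_ℂ :=
  tsum_congr fun _ => dif_pos trivial

theorem trace_ofBounded_comp_adjoint {X Y : H →L[ℂ] H} (hX : IsHilbertSchmidt (ofBounded X))
    (hY : IsHilbertSchmidt (ofBounded Y)) :
    trace (ofBounded (Y ∘L ContinuousLinearMap.adjoint X)) =
      ∑' i, ⟪X (onb H i), Y (onb H i)⟫_ℂ := by
  rw [trace_ofBounded, ← tsum_inner_adjoint (onb H) (onb H) (isHilbertSchmidt_ofBounded_iff.1 hX)
    (isHilbertSchmidt_ofBounded_iff.1 hY)]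
  refine tsum_congr fun i => ?_
  rw [ContinuousLinearMap.adjoint_inner_left]
  rfl

end TraceClass

section StateLaw

variable {α : Type*} [MeasurableSpace α] {μ : Measure α}
variable {H : Type*} [NormedAddCommGroup H] [InnerProductSpace ℂ H] [CompleteSpace H]

/-- The distribution `B ↦ Tr[1_B(A) R R*]` of the observable `A = mulOp V m` in the state
`R R*`. It is encoded as the sum of the distributions of `A` in the vector states `R eᵢ`. -/
noncomputable def stateLaw (V : Lp ℂ 2 μ ≃ₗᵢ[ℂ] H) (m : α → ℝ) (R : H →L[ℂ] H) : Measure ℝ :=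
  Measure.sum fun i => law V m (R (onb H i))

variable {V : Lp ℂ 2 μ ≃ₗᵢ[ℂ] H} {m : α → ℝ} {R : H →L[ℂ] H} {j k : ℕ}

theorem stateLaw_univ (hm : Measurable m) (R : H →L[ℂ] H) :
    stateLaw V m R Set.univ = ∑' i, ‖R (onb H i)‖ₑ ^ 2 := by
  rw [stateLaw, Measure.sum_apply _ MeasurableSet.univ]
  exact tsum_congr fun i => law_univ hm _

theorem isFiniteMeasure_stateLaw (hm : Measurable m) (hR : IsHilbertSchmidt (ofBounded R)) :
    IsFiniteMeasure (stateLaw V m R) :=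
  ⟨stateLaw_univ (V := V) hm R ▸ lt_top_iff_ne_top.2
    ((summable_norm_sq_iff_tsum_enorm_sq_ne_top _).1 (isHilbertSchmidt_ofBounded_iff.1 hR))⟩

theorem stateLaw_ne_zero (hm : Measurable m) (hR : R ≠ 0) : stateLaw V m R ≠ 0 := by
  contrapose! hR
  have hsum : ∑' i, ‖R (onb H i)‖ₑ ^ 2 = 0 := by rw [← stateLaw_univ (V := V) hm, hR]; rfl
  refine ContinuousLinearMap.ext_on
    (Submodule.dense_iff_topologicalClosure_eq_top.2 (onb H).dense_span) ?_
  rintro _ ⟨i, rfl⟩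
  simpa using ENNReal.tsum_eq_zero.1 hsum i

theorem memLp_pow_stateLaw (hm : Measurable m)
    (hk : IsHilbertSchmidt (prodOp (powOp (mulOp V fun t => (m t : ℂ)) k) (ofBounded R))) :
    MemLp (fun s : ℝ => (s : ℂ) ^ k) 2 (stateLaw V m R) := by
  obtain ⟨C, hC, hsum⟩ := hk
  have hlaw (i) : ∫⁻ s, ‖(s : ℂ) ^ k‖ₑ ^ 2 ∂law V m (R (onb H i)) = ‖C (onb H i)‖ₑ ^ 2 := by
    obtain ⟨hi, hCi⟩ := prodOp_ofBounded_eq_iff.1 hC (onb H i)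
    rw [← hCi, enorm_powOp_sq hm ⟨_, hi⟩]
  rw [memLp_two_iff_lintegral_enorm_sq_lt_top (by fun_prop), stateLaw, lintegral_sum_measure,
    tsum_congr hlaw]
  exact ((summable_norm_sq_iff_tsum_enorm_sq_ne_top _).1 hsum).lt_top

theorem isHilbertSchmidt_prodOp_powOp_of_le (hm : Measurable m) (hjk : j ≤ k)
    (hR : IsHilbertSchmidt (ofBounded R))
    (hk : IsHilbertSchmidt (prodOp (powOp (mulOp V fun t => (m t : ℂ)) k) (ofBounded R))) :
    IsHilbertSchmidt (prodOp (powOp (mulOp V fun t => (m t : ℂ)) j) (ofBounded R)) := by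
  obtain ⟨B, hB, hBsum⟩ := hk
  have hle (x : H) : ∃ hx : R x ∈ (powOp (mulOp V fun t => (m t : ℂ)) j).domain,
      ‖powOp (mulOp V fun t => (m t : ℂ)) j ⟨R x, hx⟩‖ ^ 2 ≤ ‖R x‖ ^ 2 + ‖B x‖ ^ 2 := by
    obtain ⟨hxk, hBx⟩ := prodOp_ofBounded_eq_iff.1 hB x
    have := isFiniteMeasure_law (V := V) hm (R x)
    have hxj := (mem_powOp_domain_iff hm j).2
      (memLp_ofReal_pow_of_le hjk ((mem_powOp_domain_iff hm k).1 hxk))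
    exact ⟨hxj, hBx ▸ norm_powOp_sq_le hm hjk hxj hxk⟩
  obtain ⟨C, hC⟩ : ∃ C, prodOp (powOp (mulOp V fun t => (m t : ℂ)) j) (ofBounded R) =
      ofBounded C := by
    refine exists_prodOp_ofBounded_eq (c := ‖R‖ + ‖B‖) fun x => ?_
    obtain ⟨hx, hxle⟩ := hle x
    refine ⟨hx, abs_le_of_sq_le_sq' ?_ (by positivity) |>.2⟩
    nlinarith [R.le_opNorm x, B.le_opNorm x, norm_nonneg (R x), norm_nonneg (B x)]
  refine ⟨C, hC, Summable.of_nonneg_of_le (fun i => by positivity) (fun i => ?_)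
    ((isHilbertSchmidt_ofBounded_iff.1 hR).add hBsum)⟩
  obtain ⟨hx, hCx⟩ := prodOp_ofBounded_eq_iff.1 hC (onb H i)
  exact hCx ▸ (hle _).2

theorem isTraceClass_prodOp_powOp (hm : Measurable m) (hjk : j ≤ k)
    (hR : IsHilbertSchmidt (ofBounded R))
    (hk : IsHilbertSchmidt (prodOp (powOp (mulOp V fun t => (m t : ℂ)) k) (ofBounded R))) :
    IsTraceClass (prodOp (powOp (mulOp V fun t => (m t : ℂ)) j)
      (ofBounded (R ∘L ContinuousLinearMap.adjoint R))) := by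
  obtain ⟨C, hC, hCsum⟩ := isHilbertSchmidt_prodOp_powOp_of_le hm hjk hR hk
  rw [prodOp_ofBounded_comp hC]
  exact (isHilbertSchmidt_ofBounded_iff.2 hCsum).isTraceClass_comp hR.adjoint

theorem trace_prodOp_powOp (hm : Measurable m) (hR : IsHilbertSchmidt (ofBounded R))
    (hj : IsHilbertSchmidt (prodOp (powOp (mulOp V fun t => (m t : ℂ)) j) (ofBounded R))) :
    trace (prodOp (powOp (mulOp V fun t => (m t : ℂ)) j)
        (ofBounded (R ∘L ContinuousLinearMap.adjoint R))) =
      ∫ s : ℝ, (s : ℂ) ^ j ∂stateLaw V m R := by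
  have := isFiniteMeasure_stateLaw (V := V) hm hR
  have hint : Integrable (fun s : ℝ => (s : ℂ) ^ j) (stateLaw V m R) :=
    (memLp_pow_stateLaw hm hj).integrable one_le_two
  obtain ⟨C, hC, hCsum⟩ := hj
  rw [prodOp_ofBounded_comp hC,
    trace_ofBounded_comp_adjoint hR (isHilbertSchmidt_ofBounded_iff.2 hCsum), stateLaw,
    integral_sum_measure hint]
  refine tsum_congr fun i => ?_
  obtain ⟨hi, hCi⟩ := prodOp_ofBounded_eq_iff.1 hC (onb H i)
  rw [← hCi]
  exact inner_self_powOp hm ⟨_, hi⟩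

end StateLaw

section Plancherel

variable {E F : Type*} [NormedAddCommGroup E] [InnerProductSpace ℝ E] [FiniteDimensional ℝ E]
  [MeasurableSpace E] [BorelSpace E] [NormedAddCommGroup F] [InnerProductSpace ℂ F]
  [CompleteSpace F] {g : E → F}

theorem integral_fourier_smul_eq (hg : Integrable g) (u : SchwartzMap E ℂ) :
    ∫ x, 𝓕 (u : E → ℂ) x • g x = ∫ x, u x • 𝓕 g x := by
  have h := VectorFourier.integral_fourierIntegral_smul_eq_flip (μ := volume) (ν := volume)
    (L := innerₗ E) Real.continuous_fourierChar continuous_inner u.integrable hg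
  rwa [flip_innerₗ] at h

theorem coeFn_fourier_toLp (hg₁ : Integrable g) (hg₂ : MemLp g 2) :
    ⇑(Lp.fourierTransformₗᵢ E F (hg₂.toLp g)) =ᵐ[volume] 𝓕 g := by
  refine ae_eq_of_integral_contDiff_smul_eq
    ((Lp.memLp _).locallyIntegrable (by norm_num))
    (VectorFourier.fourierIntegral_continuous Real.continuous_fourierChar
      continuous_inner hg₁).locallyIntegrable fun u hu hc => ?_
  have huc : HasCompactSupport (Complex.ofRealCLM ∘ u) := hc.comp_left rfl
  have hus : ContDiff ℝ ((⊤ : ℕ∞) : WithTop ℕ∞) (Complex.ofRealCLM ∘ u) := by fun_prop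
  let w : SchwartzMap E ℂ := huc.toSchwartzMap hus
  have hw (v : E → F) : ∫ x, u x • v x = ∫ x, w x • v x :=
    integral_congr_ae (Eventually.of_forall fun x => by simp [w])
  have hfourier := DFunLike.congr_fun (Lp.fourier_toTemperedDistribution_eq (hg₂.toLp g)) w
  simp only [TemperedDistribution.fourier_apply, Lp.toTemperedDistribution_apply] at hfourier
  calc ∫ x, u x • Lp.fourierTransformₗᵢ E F (hg₂.toLp g) x
      = ∫ x, 𝓕 w x • hg₂.toLp g x := (hw _).trans hfourier.symm
    _ = ∫ x, 𝓕 (w : E → ℂ) x • g x := by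
      refine integral_congr_ae ?_
      filter_upwards [hg₂.coeFn_toLp] with x hx
      rw [hx, SchwartzMap.fourier_coe]
    _ = ∫ x, u x • 𝓕 g x := by rw [integral_fourier_smul_eq hg₁, hw]

theorem lintegral_enorm_fourier_sq (hg₁ : Integrable g) (hg₂ : MemLp g 2) :
    ∫⁻ x, ‖𝓕 g x‖ₑ ^ 2 = ∫⁻ x, ‖g x‖ₑ ^ 2 := calc
  ∫⁻ x, ‖𝓕 g x‖ₑ ^ 2 = ∫⁻ x, ‖Lp.fourierTransformₗᵢ E F (hg₂.toLp g) x‖ₑ ^ 2 :=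
    lintegral_congr_ae ((coeFn_fourier_toLp hg₁ hg₂).fun_comp fun y => ‖y‖ₑ ^ 2).symm
  _ = ∫⁻ x, ‖hg₂.toLp g x‖ₑ ^ 2 := by
    rw [← enorm_sq_eq_lintegral, LinearIsometryEquiv.enorm_map, enorm_sq_eq_lintegral]
  _ = ∫⁻ x, ‖g x‖ₑ ^ 2 := lintegral_congr_ae (hg₂.coeFn_toLp.fun_comp fun y => ‖y‖ₑ ^ 2)

end Plancherel

section Weyl

/-- The Weyl operator `W₀(q,p)` applied pointwise to a function, so that Fourier integrals can be
computed before passing to `L²` classes. -/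
noncomputable def weylFun (q p : ℝ) (f : ℝ → ℂ) (t : ℝ) : ℂ :=
  Complex.exp (Complex.I * (q * p / 2)) * Complex.exp (Complex.I * (p * t)) * f (t + q)

theorem norm_weylFun (q p : ℝ) (f : ℝ → ℂ) (t : ℝ) : ‖weylFun q p f t‖ = ‖f (t + q)‖ := by
  have hphase (x : ℝ) : ‖Complex.exp (Complex.I * x)‖ = 1 := Complex.norm_exp_I_mul_ofReal x
  have hqp := hphase (q * p / 2)
  have hpt := hphase (p * t)
  push_cast at hqp hpt
  simp [weylFun, hqp, hpt]

theorem weylFun_congr_ae (q p : ℝ) {f g : ℝ → ℂ} (h : f =ᵐ[volume] g) :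
    weylFun q p f =ᵐ[volume] weylFun q p g := by
  filter_upwards [(measurePreserving_add_right volume q).quasiMeasurePreserving.ae h] with t ht
  rw [weylFun, weylFun, ht]

theorem coeFn_weyl₀ (q p : ℝ) (f : L2R) : ⇑(weyl₀ q p f) =ᵐ[volume] weylFun q p f :=
  MemLp.coeFn_toLp (memLp_weyl q p f)

theorem fourier_weylFun (q p : ℝ) (f : ℝ → ℂ) :
    𝓕 (weylFun q p f) = weylFun (-p / (2 * Real.pi)) (2 * Real.pi * q) (𝓕 f) := by
  ext ξ
  rw [weylFun, Real.fourier_eq', Real.fourier_eq', ← integral_sub_right_eq_self _ q,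
    ← integral_const_mul]
  refine integral_congr_ae (Eventually.of_forall fun t => ?_)
  simp only [weylFun, smul_eq_mul, RCLike.inner_apply, conj_trivial, sub_add_cancel]
  simp only [← mul_assoc, ← Complex.exp_add]
  congr 2
  have hpi : (Real.pi : ℂ) ≠ 0 := by exact_mod_cast Real.pi_ne_zero
  push_cast
  field_simp
  ring

theorem fourierTransform_weyl₀ (q p : ℝ) (f : L2R) :
    Lp.fourierTransformₗᵢ ℝ ℂ (weyl₀ q p f) =
      weyl₀ (-p / (2 * Real.pi)) (2 * Real.pi * q) (Lp.fourierTransformₗᵢ ℝ ℂ f) := by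
  induction f using (SchwartzMap.denseRange_toLpCLM (E := ℝ) (F := ℂ) (p := 2) (μ := volume)
    ENNReal.ofNat_ne_top).induction_on with
  | hp => exact isClosed_eq (by fun_prop) (by fun_prop)
  | ih s =>
    rw [SchwartzMap.toLpCLM_apply]
    have hcoe : ⇑(weyl₀ q p (s.toLp 2)) =ᵐ[volume] weylFun q p s :=
      (coeFn_weyl₀ q p _).trans (weylFun_congr_ae q p (s.coeFn_toLp 2 volume))
    have hL2 : MemLp (weylFun q p s) 2 := (Lp.memLp _).ae_eq hcoe
    have hL1 : Integrable (weylFun q p s) :=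
      (s.integrable.comp_add_right q).mono hL2.1
        (Eventually.of_forall fun t => (norm_weylFun q p s t).le)
    have hfourier : Lp.fourierTransformₗᵢ ℝ ℂ (s.toLp 2) = (𝓕 s : SchwartzMap ℝ ℂ).toLp 2 :=
      SchwartzMap.toLp_fourier_eq s
    rw [Lp.ext (hcoe.trans hL2.coeFn_toLp.symm), hfourier]
    refine Lp.ext ((coeFn_fourier_toLp hL1 hL2).trans ?_)
    rw [fourier_weylFun, ← SchwartzMap.fourier_coe]
    exact ((coeFn_weyl₀ _ _ _).trans
      (weylFun_congr_ae _ _ ((𝓕 s : SchwartzMap ℝ ℂ).coeFn_toLp 2 volume))).symm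

theorem inner_weyl₀_eq_fourier (a b : ℝ) (h φ : L2R) :
    ⟪weyl₀ a b h, φ⟫_ℂ = Complex.exp (-(Complex.I * (a * b / 2))) *
      𝓕 (fun t : ℝ => starRingEnd ℂ (h (t + a)) * φ t) (b / (2 * Real.pi)) := by
  rw [L2.inner_def, Real.fourier_eq', ← integral_const_mul]
  refine integral_congr_ae ?_
  filter_upwards [coeFn_weyl₀ a b h] with t ht
  have hphase : -2 * Real.pi * ⟪t, b / (2 * Real.pi)⟫_ℝ = -(b * t) := by
    simp only [RCLike.inner_apply, conj_trivial]
    field_simp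
  rw [ht, weylFun, hphase]
  simp only [RCLike.inner_apply, smul_eq_mul, map_mul, map_div₀, ← Complex.exp_conj,
    Complex.conj_I, Complex.conj_ofReal, Complex.conj_ofNat, Complex.ofReal_neg,
    Complex.ofReal_mul]
  ring_nf

theorem measurable_inner_weyl₀ (h φ : L2R) :
    Measurable fun z : ℝ × ℝ => ⟪weyl₀ z.1 z.2 h, φ⟫_ℂ := by
  simp only [inner_weyl₀_eq_fourier, Real.fourier_eq', RCLike.inner_apply, conj_trivial]
  have := (Lp.stronglyMeasurable h).measurable
  have := (Lp.stronglyMeasurable φ).measurable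
  have hint : StronglyMeasurable fun z : (ℝ × ℝ) × ℝ =>
      Complex.exp (↑(-2 * Real.pi * (z.1.2 / (2 * Real.pi) * z.2)) * Complex.I) •
        (starRingEnd ℂ (h (z.2 + z.1.1)) * φ z.2) := by
    refine Measurable.stronglyMeasurable ?_
    have hconj := Complex.continuous_conj.measurable
    fun_prop
  have := (hint.integral_prod_right' (ν := volume)).measurable
  fun_prop

theorem ae_lintegral_mul_shift_lt_top {f g : ℝ → ℝ≥0∞} (hf : Measurable f) (hg : Measurable g)
    (hf' : ∫⁻ t, f t ≠ ∞) (hg' : ∫⁻ t, g t ≠ ∞) : ∀ᵐ a : ℝ, ∫⁻ t, f (t + a) * g t < ∞ := by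
  refine ae_lt_top (f := fun a => ∫⁻ t, f (t + a) * g t) (by fun_prop) ?_
  calc ∫⁻ a, ∫⁻ t, f (t + a) * g t = ∫⁻ t, ∫⁻ a, f (t + a) * g t :=
        lintegral_lintegral_swap (by fun_prop)
    _ = ∫⁻ t, (∫⁻ a, f a) * g t := lintegral_congr fun t => by
        rw [lintegral_mul_const _ (by fun_prop), lintegral_add_left_eq_self f]
    _ = (∫⁻ a, f a) * ∫⁻ t, g t := lintegral_const_mul _ hg
    _ ≠ ∞ := ENNReal.mul_ne_top hf' hg'

theorem ae_lintegral_enorm_inner_weyl₀_sq (h φ : L2R) :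
    ∀ᵐ a : ℝ, ∫⁻ b, ‖⟪weyl₀ a b h, φ⟫_ℂ‖ₑ ^ 2 =
      ENNReal.ofReal (2 * Real.pi) * ∫⁻ t, ‖h (t + a)‖ₑ ^ 2 * ‖φ t‖ₑ ^ 2 := by
  have := (Lp.stronglyMeasurable h).measurable
  have := (Lp.stronglyMeasurable φ).measurable
  filter_upwards [ae_lintegral_mul_shift_lt_top (f := fun t => ‖h t‖ₑ ^ 2)
    (g := fun t => ‖φ t‖ₑ ^ 2) (by fun_prop) (by fun_prop)
    (by rw [← enorm_sq_eq_lintegral]; finiteness) (by rw [← enorm_sq_eq_lintegral]; finiteness)]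
    with a ha
  set g : ℝ → ℂ := fun t => starRingEnd ℂ (h (t + a)) * φ t with hg
  have hshift : MemLp (fun t => h (t + a)) 2 volume :=
    (Lp.memLp h).comp_measurePreserving (measurePreserving_add_right volume a)
  have hL1 : Integrable g := hshift.star.integrable_mul (Lp.memLp φ)
  have hsq (t : ℝ) : ‖g t‖ₑ ^ 2 = ‖h (t + a)‖ₑ ^ 2 * ‖φ t‖ₑ ^ 2 := by
    simp only [hg, enorm_mul, mul_pow, RCLike.enorm_conj]
  have hL2 : MemLp g 2 volume := by
    rw [memLp_two_iff_lintegral_enorm_sq_lt_top hL1.1]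
    simpa only [hsq] using ha
  have hinner (b : ℝ) : ‖⟪weyl₀ a b h, φ⟫_ℂ‖ₑ = ‖𝓕 g ((2 * Real.pi)⁻¹ * b)‖ₑ := by
    have hphase := Complex.norm_exp_I_mul_ofReal (-(a * b / 2))
    push_cast at hphase
    rw [inner_weyl₀_eq_fourier, enorm_mul, ← mul_neg, ← ofReal_norm (Complex.exp _), hphase,
      ENNReal.ofReal_one, one_mul, inv_mul_eq_div]
  have hcont : Continuous (𝓕 g) :=
    VectorFourier.fourierIntegral_continuous Real.continuous_fourierChar continuous_inner hL1
  calc ∫⁻ b, ‖⟪weyl₀ a b h, φ⟫_ℂ‖ₑ ^ 2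
      = ∫⁻ x, ‖𝓕 g x‖ₑ ^ 2 ∂volume.map ((2 * Real.pi)⁻¹ * ·) := by
        simp only [hinner]
        rw [lintegral_map (by fun_prop) (by fun_prop)]
    _ = ENNReal.ofReal (2 * Real.pi) * ∫⁻ t, ‖h (t + a)‖ₑ ^ 2 * ‖φ t‖ₑ ^ 2 := by
        rw [Real.map_volume_mul_left (by positivity), lintegral_smul_measure,
          lintegral_enorm_fourier_sq hL1 hL2, inv_inv, abs_of_pos (by positivity)]
        simp only [hsq, smul_eq_mul]

theorem lintegral_mul_enorm_inner_weyl₀_sq (h φ : L2R) {u : ℝ → ℝ≥0∞} (hu : Measurable u) :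
    ∫⁻ z : ℝ × ℝ, u z.1 * ‖⟪weyl₀ (-z.1) z.2 h, φ⟫_ℂ‖ₑ ^ 2 =
      ENNReal.ofReal (2 * Real.pi) *
        ∫⁻ t, ∫⁻ s, u (t - s) * (‖h s‖ₑ ^ 2 * ‖φ t‖ₑ ^ 2) := by
  have hh := (Lp.stronglyMeasurable h).measurable
  have hφ := (Lp.stronglyMeasurable φ).measurable
  have hm : Measurable fun z : ℝ × ℝ => ⟪weyl₀ (-z.1) z.2 h, φ⟫_ℂ :=
    (measurable_inner_weyl₀ h φ).comp (f := fun z : ℝ × ℝ => (-z.1, z.2)) (by fun_prop)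
  have hslice : ∀ᵐ x : ℝ, ∫⁻ y, u x * ‖⟪weyl₀ (-x) y h, φ⟫_ℂ‖ₑ ^ 2 =
      ENNReal.ofReal (2 * Real.pi) * ∫⁻ t, u x * (‖h (t - x)‖ₑ ^ 2 * ‖φ t‖ₑ ^ 2) := by
    filter_upwards [(Measure.measurePreserving_neg volume).quasiMeasurePreserving.ae
      (ae_lintegral_enorm_inner_weyl₀_sq h φ)] with x hx
    have hmx : Measurable fun y : ℝ => ⟪weyl₀ (-x) y h, φ⟫_ℂ :=
      hm.comp (f := fun y : ℝ => (x, y)) (by fun_prop)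
    rw [lintegral_const_mul _ (by fun_prop), hx, lintegral_const_mul _ (by fun_prop),
      mul_left_comm]
    simp only [sub_eq_add_neg]
  calc ∫⁻ z : ℝ × ℝ, u z.1 * ‖⟪weyl₀ (-z.1) z.2 h, φ⟫_ℂ‖ₑ ^ 2
      = ∫⁻ x, ∫⁻ y, u x * ‖⟪weyl₀ (-x) y h, φ⟫_ℂ‖ₑ ^ 2 := by
        rw [Measure.volume_eq_prod, lintegral_prod _ (by fun_prop)]
    _ = ENNReal.ofReal (2 * Real.pi) *
          ∫⁻ x, ∫⁻ t, u x * (‖h (t - x)‖ₑ ^ 2 * ‖φ t‖ₑ ^ 2) := by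
        rw [lintegral_congr_ae hslice, lintegral_const_mul _ (by fun_prop)]
    _ = ENNReal.ofReal (2 * Real.pi) *
          ∫⁻ t, ∫⁻ s, u (t - s) * (‖h s‖ₑ ^ 2 * ‖φ t‖ₑ ^ 2) := by
        rw [lintegral_lintegral_swap
          (f := fun x t => u x * (‖h (t - x)‖ₑ ^ 2 * ‖φ t‖ₑ ^ 2)) (by fun_prop)]
        congr 1
        refine lintegral_congr fun t => ?_
        rw [← lintegral_sub_left_eq_self _ t]
        simp only [sub_sub_cancel]

end Weyl

section PhaseSpaceTranslations

theorem stronglyMeasurable_of_inner_hilbertBasis {Ω ι 𝕜 H : Type*} [MeasurableSpace Ω]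
    [Countable ι] [RCLike 𝕜] [NormedAddCommGroup H] [InnerProductSpace 𝕜 H]
    (b : HilbertBasis ι 𝕜 H) {f : Ω → H} (hf : ∀ i, Measurable fun z => ⟪b i, f z⟫_𝕜) :
    StronglyMeasurable f := by
  refine stronglyMeasurable_of_tendsto (f := fun (s : Finset ι) z => ∑ i ∈ s, ⟪b i, f z⟫_𝕜 • b i)
    atTop (fun s => Finset.stronglyMeasurable_fun_sum s fun i _ =>
      (hf i).stronglyMeasurable.smul_const (b i)) ?_
  refine tendsto_pi_nhds.2 fun z => ?_
  have h := b.hasSum_repr (f z)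
  simp only [b.repr_apply_apply] at h
  exact h

theorem lintegral_sub_law_prod {α : Type*} [MeasurableSpace α] {μ : Measure α} [SFinite μ]
    {H : Type*} [NormedAddCommGroup H] [InnerProductSpace ℂ H] {V : Lp ℂ 2 μ ≃ₗᵢ[ℂ] H}
    {m : α → ℝ} (hm : Measurable m) {u : ℝ → ℝ≥0∞} (hu : Measurable u) (φ ψ : H) :
    ∫⁻ p, u (p.1 - p.2) ∂(law V m φ).prod (law V m ψ) =
      ∫⁻ t, ∫⁻ s, u (m t - m s) * (‖V.symm ψ s‖ₑ ^ 2 * ‖V.symm φ t‖ₑ ^ 2) ∂μ ∂μ := by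
  have := isFiniteMeasure_law (V := V) hm ψ
  rw [lintegral_prod _ (by fun_prop), lintegral_law hm φ
    (g := fun t => ∫⁻ s, u (t - s) ∂law V m ψ) (by fun_prop)]
  refine lintegral_congr fun t => ?_
  rw [lintegral_law hm ψ (g := fun s => u (m t - s)) (by fun_prop),
    ← lintegral_mul_const' _ _ (by finiteness)]
  simp only [mul_assoc]

variable {H : Type*} [NormedAddCommGroup H] [InnerProductSpace ℂ H]

/-- `V` represents the Weyl operators `W(-q,p)` on `H` as the operators `W₀(-q',p')` on `L²(ℝ)`,
where `(q',p') = r (q,p)` for a measure preserving map `r` of the phase space. This treats the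
position and the momentum representation alike: the Fourier transform turns the phase space by a
right angle. -/
structure IntertwinesWeyl (U V : L2R ≃ₗᵢ[ℂ] H) (r : ℝ × ℝ → ℝ × ℝ) : Prop where
  measurePreserving : MeasurePreserving r volume volume
  weyl_apply : ∀ z h, weyl U (-z.1) z.2 (V h) = V (weyl₀ (-(r z).1) (r z).2 h)

theorem intertwinesWeyl_id (U : L2R ≃ₗᵢ[ℂ] H) : IntertwinesWeyl U U id where
  measurePreserving := .id _
  weyl_apply z h := by simp [weyl]

theorem measurePreserving_scaled_rotation {c : ℝ} (hc : 0 < c) :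
    MeasurePreserving (fun z : ℝ × ℝ => (z.2 / c, c * -z.1)) volume volume := by
  have hscale : MeasurePreserving (Prod.map (· / c) (c * ·)) (volume : Measure (ℝ × ℝ)) volume := by
    refine ⟨by fun_prop, ?_⟩
    rw [Measure.volume_eq_prod, ← Measure.map_prod_map _ _ (by fun_prop) (by fun_prop),
      Real.map_volume_mul_left hc.ne']
    simp only [div_eq_mul_inv]
    rw [Real.map_volume_mul_right (inv_ne_zero hc.ne'), Measure.prod_smul_left,
      Measure.prod_smul_right, smul_smul, ← ENNReal.ofReal_mul (abs_nonneg _), ← abs_mul,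
      inv_inv, mul_inv_cancel₀ hc.ne', abs_one, ENNReal.ofReal_one, one_smul]
  exact hscale.comp ((MeasurePreserving.id volume).prod
    (Measure.measurePreserving_neg volume) |>.comp Measure.measurePreserving_swap)

theorem intertwinesWeyl_fourier (U : L2R ≃ₗᵢ[ℂ] H) :
    IntertwinesWeyl U ((Lp.fourierTransformₗᵢ ℝ ℂ).symm.trans U)
      fun z => (z.2 / (2 * Real.pi), 2 * Real.pi * -z.1) where
  measurePreserving := measurePreserving_scaled_rotation (by positivity)
  weyl_apply z h := by
    have hF := fourierTransform_weyl₀ (-z.1) z.2 ((Lp.fourierTransformₗᵢ ℝ ℂ).symm h)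
    rw [LinearIsometryEquiv.apply_symm_apply, neg_div] at hF
    change U (weyl₀ (-z.1) z.2 (U.symm (U ((Lp.fourierTransformₗᵢ ℝ ℂ).symm h)))) =
      U ((Lp.fourierTransformₗᵢ ℝ ℂ).symm (weyl₀ (-(z.2 / (2 * Real.pi))) (2 * Real.pi * -z.1) h))
    rw [← hF, LinearIsometryEquiv.symm_apply_apply, LinearIsometryEquiv.symm_apply_apply]

variable [CompleteSpace H] {U V : L2R ≃ₗᵢ[ℂ] H} {R : H →L[ℂ] H}

/-- The operator `(W(-q,p) R)*`. It factorizes the phase space translations of a state `R R*`, as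
`β(z)(R R*) = (W(-q,p) R) (W(-q,p) R)*`. -/
noncomputable def weylAdjoint (U : L2R ≃ₗᵢ[ℂ] H) (R : H →L[ℂ] H) (z : ℝ × ℝ) : H →L[ℂ] H :=
  ContinuousLinearMap.adjoint (weyl U (-z.1) z.2 ∘L R)

theorem inner_beta_comp_adjoint (z : ℝ × ℝ) (ψ φ : H) :
    ⟪ψ, beta U z (R ∘L ContinuousLinearMap.adjoint R) φ⟫_ℂ =
      ⟪weylAdjoint U R z ψ, weylAdjoint U R z φ⟫_ℂ := by
  rw [weylAdjoint, ContinuousLinearMap.adjoint_inner_left, ContinuousLinearMap.adjoint_comp]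
  rfl

theorem countable_basisIndex (U : L2R ≃ₗᵢ[ℂ] H) : Countable (basisIndex H) := by
  have : Fact ((2 : ℝ≥0∞) ≠ ∞) := ⟨by simp⟩
  have := U.surjective.denseRange.separableSpace U.continuous
  exact countable_of_hilbertBasis (onb H)

namespace IntertwinesWeyl

variable {r : ℝ × ℝ → ℝ × ℝ}

theorem inner_weylAdjoint (h : IntertwinesWeyl U V r) (z : ℝ × ℝ) (x φ : H) :
    ⟪x, weylAdjoint U R z φ⟫_ℂ =
      ⟪weyl₀ (-(r z).1) (r z).2 (V.symm (R x)), V.symm φ⟫_ℂ := by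
  rw [weylAdjoint, ContinuousLinearMap.adjoint_inner_right, ContinuousLinearMap.comp_apply,
    ← V.inner_map_map, ← h.weyl_apply, V.apply_symm_apply, V.apply_symm_apply]

theorem measurable_inner_weylAdjoint (h : IntertwinesWeyl U V r) (x φ : H) :
    Measurable fun z => ⟪x, weylAdjoint U R z φ⟫_ℂ := by
  simp only [h.inner_weylAdjoint]
  have hr := h.measurePreserving.measurable
  exact (measurable_inner_weyl₀ (V.symm (R x)) (V.symm φ)).comp
    (f := fun z => (-(r z).1, (r z).2)) (by fun_prop)

variable {m : ℝ → ℝ} {u : ℝ → ℝ≥0∞}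

theorem lintegral_mul_enorm_inner_weylAdjoint_sq (h : IntertwinesWeyl U V r)
    (hm : Measurable m) (hsub : ∀ s t, m (t - s) = m t - m s) (hu : Measurable u) (x φ : H) :
    ∫⁻ z, u (m (r z).1) * ‖⟪x, weylAdjoint U R z φ⟫_ℂ‖ₑ ^ 2 =
      ENNReal.ofReal (2 * Real.pi) *
        ∫⁻ p, u (p.1 - p.2) ∂(law V m φ).prod (law V m (R x)) := by
  have hmeas : Measurable fun z : ℝ × ℝ =>
      ⟪weyl₀ (-z.1) z.2 (V.symm (R x)), V.symm φ⟫_ℂ :=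
    (measurable_inner_weyl₀ _ _).comp (f := fun z : ℝ × ℝ => (-z.1, z.2)) (by fun_prop)
  simp only [h.inner_weylAdjoint]
  rw [h.measurePreserving.lintegral_comp (f := fun z => u (m z.1) *
      ‖⟪weyl₀ (-z.1) z.2 (V.symm (R x)), V.symm φ⟫_ℂ‖ₑ ^ 2) (by fun_prop),
    lintegral_mul_enorm_inner_weyl₀_sq _ _ (u := fun t => u (m t)) (by fun_prop),
    lintegral_sub_law_prod hm hu]
  simp only [hsub]

theorem lintegral_mul_enorm_weylAdjoint_sq (h : IntertwinesWeyl U V r)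
    (hm : Measurable m) (hsub : ∀ s t, m (t - s) = m t - m s) (hu : Measurable u) (φ : H) :
    ∫⁻ z, u (m (r z).1) * ‖weylAdjoint U R z φ‖ₑ ^ 2 =
      ENNReal.ofReal (2 * Real.pi) *
        ∫⁻ p, u (p.1 - p.2) ∂(law V m φ).prod (stateLaw V m R) := by
  have := countable_basisIndex U
  have (ψ : H) := isFiniteMeasure_law (V := V) hm ψ
  have hr := h.measurePreserving.measurable
  have hmeas (i : basisIndex H) := h.measurable_inner_weylAdjoint (R := R) (onb H i) φ
  simp only [← tsum_enorm_inner_sq (onb H), ← ENNReal.tsum_mul_left]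
  rw [lintegral_tsum (by fun_prop), stateLaw, Measure.prod_sum_right, lintegral_sum_measure,
    ← ENNReal.tsum_mul_left]
  exact tsum_congr fun i => h.lintegral_mul_enorm_inner_weylAdjoint_sq hm hsub hu _ φ

end IntertwinesWeyl

theorem memLp_weylAdjoint (U : L2R ≃ₗᵢ[ℂ] H) (hR : IsHilbertSchmidt (ofBounded R)) (φ : H) :
    MemLp (fun z => weylAdjoint U R z φ) 2 := by
  have := countable_basisIndex U
  have hU := intertwinesWeyl_id U
  have hmeas := stronglyMeasurable_of_inner_hilbertBasis (onb H) fun i =>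
    hU.measurable_inner_weylAdjoint (R := R) (onb H i) φ
  have := isFiniteMeasure_law (V := U) measurable_id φ
  have := isFiniteMeasure_stateLaw (V := U) measurable_id hR
  have hint := hU.lintegral_mul_enorm_weylAdjoint_sq (R := R) measurable_id
    (fun _ _ => rfl) measurable_one φ
  simp only [Pi.one_apply, one_mul, lintegral_one] at hint
  rw [memLp_two_iff_lintegral_enorm_sq_lt_top hmeas.aestronglyMeasurable, hint]
  finiteness

end PhaseSpaceTranslations

section CovariantObservable

variable {H : Type*} [NormedAddCommGroup H] [InnerProductSpace ℂ H] [CompleteSpace H]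
variable {U V : L2R ≃ₗᵢ[ℂ] H} {R : H →L[ℂ] H}

/-- The normalized Lebesgue measure `dq dp / 2π` of the phase space. -/
noncomputable def phaseVolume : Measure (ℝ × ℝ) := ENNReal.ofReal (2 * Real.pi)⁻¹ • volume

theorem memLp_weylAdjoint_phaseVolume (U : L2R ≃ₗᵢ[ℂ] H) (hR : IsHilbertSchmidt (ofBounded R))
    (φ : H) : MemLp (fun z => weylAdjoint U R z φ) 2 phaseVolume :=
  (memLp_weylAdjoint U hR φ).smul_measure ENNReal.ofReal_ne_top

theorem isGeneratedBy_comp_adjoint_iff (hR : IsHilbertSchmidt (ofBounded R))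
    {E : PositiveOperatorMeasure (ℝ × ℝ) H} :
    IsGeneratedBy U (R ∘L ContinuousLinearMap.adjoint R) E ↔
      ∀ B, MeasurableSet B → ∀ ψ φ, ⟪ψ, E.toFun B φ⟫_ℂ =
        ∫ z in B, ⟪weylAdjoint U R z ψ, weylAdjoint U R z φ⟫_ℂ ∂phaseVolume := by
  have hvolume (B : Set (ℝ × ℝ)) (f : ℝ × ℝ → ℂ) :
      ∫ z in B, f z ∂phaseVolume = (2 * (Real.pi : ℂ))⁻¹ * ∫ z in B, f z := by
    rw [phaseVolume, Measure.restrict_smul, integral_smul_measure,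
      ENNReal.toReal_ofReal (by positivity), Complex.real_smul]
    push_cast
    rfl
  have hint (B : Set (ℝ × ℝ)) (ψ φ : H) :
      IntegrableOn (fun z => ⟪weylAdjoint U R z ψ, weylAdjoint U R z φ⟫_ℂ) B :=
    (integrable_inner_of_memLp_two (memLp_weylAdjoint U hR ψ)
      (memLp_weylAdjoint U hR φ)).integrableOn
  simp only [IsGeneratedBy, inner_beta_comp_adjoint, hvolume, hint, true_and]

theorem isGeneratedBy_covariantObservable (U : L2R ≃ₗᵢ[ℂ] H)
    (hR : IsHilbertSchmidt (ofBounded R)) :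
    IsGeneratedBy U (R ∘L ContinuousLinearMap.adjoint R)
      (covariantObservable U (R ∘L ContinuousLinearMap.adjoint R)) := by
  obtain ⟨E, hE⟩ :=
    exists_positiveOperatorMeasure_inner_eq_setIntegral (memLp_weylAdjoint_phaseVolume U hR)
  have hex : ∃ E, IsGeneratedBy U (R ∘L ContinuousLinearMap.adjoint R) E :=
    ⟨E, (isGeneratedBy_comp_adjoint_iff hR).2 hE⟩
  rw [covariantObservable, dif_pos hex]
  exact hex.choose_spec

theorem diag_covariantObservable (U : L2R ≃ₗᵢ[ℂ] H) (hR : IsHilbertSchmidt (ofBounded R))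
    (φ : H) :
    (covariantObservable U (R ∘L ContinuousLinearMap.adjoint R)).diag φ =
      phaseVolume.withDensity fun z => ‖weylAdjoint U R z φ‖ₑ ^ 2 :=
  diag_eq_withDensity (memLp_weylAdjoint_phaseVolume U hR φ) fun B hB =>
    (isGeneratedBy_comp_adjoint_iff hR).1 (isGeneratedBy_covariantObservable U hR) B hB φ φ

theorem IntertwinesWeyl.map_diag_covariantObservable {r : ℝ × ℝ → ℝ × ℝ}
    (h : IntertwinesWeyl U V r) {m : ℝ → ℝ} (hm : Measurable m)
    (hsub : ∀ s t, m (t - s) = m t - m s) (hR : IsHilbertSchmidt (ofBounded R)) (φ : H) :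
    ((covariantObservable U (R ∘L ContinuousLinearMap.adjoint R)).diag φ).map
        (fun z => m (r z).1) =
      ((law V m φ).prod (stateLaw V m R)).map fun p => p.1 - p.2 := by
  have hx : Measurable fun z => m (r z).1 := hm.comp h.measurePreserving.measurable.fst
  refine Measure.ext_of_lintegral _ fun u hu => ?_
  have hux : Measurable fun z => u (m (r z).1) := hu.comp hx
  rw [lintegral_map hu hx, lintegral_map hu (by fun_prop), diag_covariantObservable U hR,
    lintegral_withDensity_eq_lintegral_mul₀
      ((memLp_weylAdjoint_phaseVolume U hR φ).1.enorm.pow_const 2) hux.aemeasurable, phaseVolume,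
    lintegral_smul_measure]
  simp only [Pi.mul_apply, mul_comm _ (u _)]
  rw [h.lintegral_mul_enorm_weylAdjoint_sq hm hsub hu, smul_eq_mul, ← mul_assoc,
    ← ENNReal.ofReal_mul (by positivity), inv_mul_cancel₀ (by positivity), ENNReal.ofReal_one,
    one_mul]

end CovariantObservable

section Moments

variable {H : Type*} [NormedAddCommGroup H] [InnerProductSpace ℂ H]

theorem opP_eq_mulOp (U : L2R ≃ₗᵢ[ℂ] H) :
    opP U = mulOp ((Lp.fourierTransformₗᵢ ℝ ℂ).symm.trans U)
      fun t => ((2 * Real.pi * t : ℝ) : ℂ) := by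
  have hsmul : (2 * (Real.pi : ℂ)) • position =
      mulL2 volume fun t => ((2 * Real.pi * t : ℝ) : ℂ) := by
    push_cast
    exact smul_mulL2 (by simp [Real.pi_ne_zero])
  rw [mulOp, ← hsmul]
  rfl

variable [CompleteSpace H] {U V : L2R ≃ₗᵢ[ℂ] H} {k : ℕ}

theorem adjoint_sqrt (T : H →L[ℂ] H) : ContinuousLinearMap.adjoint (CFC.sqrt T) = CFC.sqrt T :=
  IsSelfAdjoint.of_nonneg (CFC.sqrt_nonneg T)

theorem isHilbertSchmidt_sqrt {T : H →L[ℂ] H} (hT : T.IsPositive)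
    (hT_class : IsTraceClass (ofBounded T)) : IsHilbertSchmidt (ofBounded (CFC.sqrt T)) := by
  have hT0 : 0 ≤ T := (ContinuousLinearMap.nonneg_iff_isPositive T).2 hT
  obtain ⟨T', hT', hsum⟩ := hT_class
  rw [← ofBounded_injective hT', CFC.abs_of_nonneg T hT0] at hsum
  refine isHilbertSchmidt_ofBounded_iff.2 (hsum.congr fun i => ?_)
  rw [norm_sq_eq_re_inner (𝕜 := ℂ), ← ContinuousLinearMap.adjoint_inner_right, adjoint_sqrt,
    ← mul_apply_eq_comp, CFC.sqrt_mul_sqrt_self T hT0]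
  rfl

theorem IntertwinesWeyl.operatorIntegral_eq_momentPolynomial {r : ℝ × ℝ → ℝ × ℝ}
    (h : IntertwinesWeyl U V r) {m : ℝ → ℝ} (hm : Measurable m)
    (hsub : ∀ s t, m (t - s) = m t - m s) {R : H →L[ℂ] H} (hR : IsHilbertSchmidt (ofBounded R))
    (hR0 : R ≠ 0)
    (hk : IsHilbertSchmidt (prodOp (powOp (mulOp V fun t => (m t : ℂ)) k) (ofBounded R)))
    (hf : Measurable fun z => (m (r z).1 : ℂ) ^ k) :
    (covariantObservable U (R ∘L ContinuousLinearMap.adjoint R)).operatorIntegral hf =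
      momentPolynomial (mulOp V fun t => (m t : ℂ)) (R ∘L ContinuousLinearMap.adjoint R) k := by
  have := isFiniteMeasure_stateLaw (V := V) hm hR
  have : NeZero (stateLaw V m R) := ⟨stateLaw_ne_zero hm hR0⟩
  have hx : Measurable fun z => m (r z).1 := hm.comp h.measurePreserving.measurable.fst
  rw [operatorIntegral_pow_eq_sum_smul_powOp hm hx (memLp_pow_stateLaw hm hk)
    (h.map_diag_covariantObservable hm hsub hR) hf, momentPolynomial]
  refine Finset.sum_congr rfl fun l _ => ?_
  rw [trace_prodOp_powOp hm hR (isHilbertSchmidt_prodOp_powOp_of_le hm (Nat.sub_le k l) hR hk)]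

theorem IntertwinesWeyl.isTraceClass_and_operatorIntegral_eq {r : ℝ × ℝ → ℝ × ℝ}
    (h : IntertwinesWeyl U V r) {m : ℝ → ℝ} (hm : Measurable m)
    (hsub : ∀ s t, m (t - s) = m t - m s) {T : H →L[ℂ] H} (hT : T.IsPositive)
    (hT_class : IsTraceClass (ofBounded T)) (hT0 : T ≠ 0)
    (hk : IsHilbertSchmidt
      (prodOp (powOp (mulOp V fun t => (m t : ℂ)) k) (ofBounded (CFC.sqrt T))))
    {f : ℝ × ℝ → ℂ} (hf : Measurable f) (hfm : ∀ z, f z = (m (r z).1 : ℂ) ^ k) :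
    (∀ l ≤ k, IsTraceClass
      (prodOp (powOp (mulOp V fun t => (m t : ℂ)) (k - l)) (ofBounded T))) ∧
    (covariantObservable U T).operatorIntegral hf =
      momentPolynomial (mulOp V fun t => (m t : ℂ)) T k := by
  obtain rfl : f = fun z => (m (r z).1 : ℂ) ^ k := funext hfm
  have hR := isHilbertSchmidt_sqrt hT hT_class
  have hRR : CFC.sqrt T ∘L ContinuousLinearMap.adjoint (CFC.sqrt T) = T := by
    rw [adjoint_sqrt]
    exact CFC.sqrt_mul_sqrt_self T ((ContinuousLinearMap.nonneg_iff_isPositive T).2 hT)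
  have hR0 : CFC.sqrt T ≠ 0 := fun h0 => hT0 (by rw [← hRR, h0, ContinuousLinearMap.zero_comp])
  have htrace (l : ℕ) (_ : l ≤ k) := isTraceClass_prodOp_powOp hm (Nat.sub_le k l) hR hk
  have hint := h.operatorIntegral_eq_momentPolynomial hm hsub hR hR0 hk hf
  simp only [hRR] at htrace hint
  exact ⟨htrace, hint⟩

end Moments

end PhaseSpaceQuantization

theorem mainTheorem1_general {H : Type*} [NormedAddCommGroup H] [InnerProductSpace ℂ H]
    [CompleteSpace H] (U : L2R ≃ₗᵢ[ℂ] H) (T : H →L[ℂ] H) (hT : T.IsPositive)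
    (hT_class : IsTraceClass (ofBounded T)) (hT0 : T ≠ 0) (k : ℕ) :
    (IsHilbertSchmidt (prodOp (powOp (opQ U) k) (ofBounded (CFC.sqrt T))) →
      (∀ l ≤ k, IsTraceClass (prodOp (powOp (opQ U) (k - l)) (ofBounded T))) ∧
      (covariantObservable U T).operatorIntegral (measurable_xPow k) =
        momentPolynomial (opQ U) T k) ∧
    (IsHilbertSchmidt (prodOp (powOp (opP U) k) (ofBounded (CFC.sqrt T))) →
      (∀ l ≤ k, IsTraceClass (prodOp (powOp (opP U) (k - l)) (ofBounded T))) ∧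
      (covariantObservable U T).operatorIntegral (measurable_yPow k) =
        momentPolynomial (opP U) T k) := by
  refine ⟨fun hk => ?_, fun hk => ?_⟩
  · exact (intertwinesWeyl_id U).isTraceClass_and_operatorIntegral_eq measurable_id
      (fun _ _ => rfl) hT hT_class hT0 hk (measurable_xPow k) fun _ => rfl
  · rw [opP_eq_mulOp] at hk ⊢
    exact (intertwinesWeyl_fourier U).isTraceClass_and_operatorIntegral_eq
      (measurable_const_mul _) (fun _ _ => mul_sub _ _ _) hT hT_class hT0 hk (measurable_yPow k)
      fun z => by rw [yPow, mul_div_cancel₀ _ (by positivity)]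

theorem mainTheorem1 {H : Type*} [NormedAddCommGroup H] [InnerProductSpace ℂ H] [CompleteSpace H]
    (U : L2R ≃ₗᵢ[ℂ] H) (T : H →L[ℂ] H) (hT : T.IsPositive)
    (hT_class : IsTraceClass (ofBounded T)) (hT_one : trace (ofBounded T) = 1) (k : ℕ) :
    (IsHilbertSchmidt (prodOp (powOp (opQ U) k) (ofBounded (CFC.sqrt T))) →
      (∀ l ≤ k, IsTraceClass (prodOp (powOp (opQ U) (k - l)) (ofBounded T))) ∧
      (covariantObservable U T).operatorIntegral (measurable_xPow k) =
        momentPolynomial (opQ U) T k) ∧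
    (IsHilbertSchmidt (prodOp (powOp (opP U) k) (ofBounded (CFC.sqrt T))) →
      (∀ l ≤ k, IsTraceClass (prodOp (powOp (opP U) (k - l)) (ofBounded T))) ∧
      (covariantObservable U T).operatorIntegral (measurable_yPow k) =
        momentPolynomial (opP U) T k) :=
  mainTheorem1_general U T hT hT_class (by rintro rfl; simp [trace_ofBounded] at hT_one) k
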